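/- **Setting.** Let $J:\mathbb{R}^p\to\mathbb{R}$ be a finite-valued convex function with subdifferential $\partial J$. For $\beta\in\mathbb{R}^p$ let $T_\beta=\big(\operatorname{span}\{\eta-\eta' : \eta,\eta'\in\partial J(\beta)\}\big)^\perp$. For a set $\mathcal{M}\ni\beta$, $J$ is *partly smooth at $\beta$ relative to $\mathcal{M}$* if (i) $\mathcal{M}$ is a $C^2$-manifold around $\beta$ and $J$ restricted to $\mathcal{M}$ is $C^2$ around $\beta$; (ii) the tangent space of $\mathcal{M}$ at $\beta$ is $T_\beta$; (iii) the set-valued map $\partial J$ is continuous at $\beta$ relative to $\mathcal{M}$. $J$ is *locally partly smooth at $\beta$ relative to $\mathcal{M}\ni\beta$* if $\mathcal{M}$ is a $C^2$-manifold and $J$ is partly smooth relative to $\mathcal{M}$ at every point of $\mathcal{M}\cap U$ for some neighbourhood $U$ of $\beta$. Let $\beta_0\in\mathbb{R}^p$ and assume that $J$ is locally partly smooth at $\beta_0$ relative to $\mathcal{M}$. Put $T=T_{\beta_0}$, let $P_T$ be the orthogonal projection onto $T$, and let $e$ be the only element of $P_T(\partial J(\beta_0))$. Let $(\xi_i,w_i)_{i\ge1}$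 be i.i.d. random vectors in $\mathbb{R}^p\times\mathbb{R}$ (not necessarily with $\xi_i$ and $w_i$ independent of each other) such that $\mathbb{E}(w_i\mid\xi_i)=0$, $\mathbb{E}(w_i^4)<\infty$ and $\mathbb{E}(\|\xi_i\|^4)<\infty$. Let $\tilde\Gamma=\mathbb{E}(\xi^*\xi)\in\mathbb{R}^{p\times p}$, where the row vector $\xi$ is distributed as the $\xi_i$. For each $n\geq 1$ let $X_n\in\mathbb{R}^{n\times p}$ be the matrix with rows $\xi_1,\dots,\xi_n$, let $w^{(n)}=(w_1,\dots,w_n)$, $y_n=X_n\beta_0+w^{(n)}$, $\Gamma_n=X_n^*X_n/n$, $u_n=X_n^*y_n/n$. For $\mu_n>0$ consider, with $A^+$ denoting the Moore–Penrose pseudo-inverse of $A$, the problem $$\min_{\beta\in\mathbb{R}^p}\; J(\beta)+\frac{1}{2\mu_n}\langle\Gamma_n\beta,\beta\rangle-\frac1{\mu_n}\langle\beta,u_n\rangle+\frac1{2\mu_n}\langle\Gamma_n^+u_n,u_n\rangle .\qquad(\mathcal{P}_{\theta_n})$$ **Theorem.** Assume that $$\ker(\tilde\Gamma)\cap T=\{0\}\quad\text{and}\quad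 \tilde\Gamma\,(P_T\tilde\Gamma P_T)^+e\in\operatorname{ri}(\partial J(\beta_0)),$$ where $\operatorname{ri}$ denotes the relative interior, and that the deterministic sequence $\mu_n>0$ satisfies $\mu_n=o(1)$ and $\mu_n^{-1}=o(n^{1/2})$ as $n\to\infty$. Then the estimator obtained by solving $(\mathcal{P}_{\theta_n})$ is model consistent: the probability that $(\mathcal{P}_{\theta_n})$ has a unique solution $\beta_{\theta_n}$ and that $\beta_{\theta_n}\in\mathcal{M}$ tends to $1$ as $n\to\infty$. -/

import Mathlib

open MeasureTheory ProbabilityTheory Filter Topology Asymptotics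
open scoped RealInnerProductSpace Matrix

noncomputable section

namespace PartlySmooth

/-! ### Convex analysis and partial smoothness -/

section Convex

variable {E : Type*} [NormedAddCommGroup E] [InnerProductSpace ℝ E]

/-- The subdifferential `∂J(β)` of a finite-valued (convex) function. -/
def subdiff (J : E → ℝ) (β : E) : Set E :=
  {η | ∀ x, J β + ⟪η, x - β⟫ ≤ J x}

/-- The tangent model subspace `T_β = VectHull(∂J(β))^⊥`. Here `vectorSpan ℝ C` is the span of the
differences of elements of `C`, that is, the direction of the affine hull of `C`. -/
def tangentModel (J : E → ℝ) (β : E) : Submodule ℝ E :=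
  (vectorSpan ℝ (subdiff J β))ᗮ

/-- `F = 0` is a regular `C²` equation of `M` around `β`: `F` is `C²` around `β`, its derivative
at `β` is onto, and near `β` the set `M` is the zero set of `F`. -/
structure IsLocalEquation (M : Set E) (β : E) {m : ℕ} (F : E → EuclideanSpace ℝ (Fin m)) :
    Prop where
  contDiffAt : ContDiffAt ℝ 2 F β
  surjective : Function.Surjective (fderiv ℝ F β)
  eventually_mem_iff : ∀ᶠ x in 𝓝 β, (x ∈ M ↔ F x = 0)

/-- `M` is a `C²` (embedded) manifold around `β`. -/
def IsC2ManifoldAt (M : Set E) (β : E) : Prop :=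
  ∃ (m : ℕ) (F : E → EuclideanSpace ℝ (Fin m)), IsLocalEquation M β F

/-- `T` is the tangent space at `β` of the `C²` manifold `M`: the kernel of the derivative of a
local equation (at a point `β ∈ M` it does not depend on the equation). -/
def HasTangentSpaceAt (M : Set E) (β : E) (T : Submodule ℝ E) : Prop :=
  ∃ (m : ℕ) (F : E → EuclideanSpace ℝ (Fin m)),
    IsLocalEquation M β F ∧ LinearMap.ker (fderiv ℝ F β : E →ₗ[ℝ] EuclideanSpace ℝ (Fin m)) = T

/-- The restriction of `J` to `M` is `C²` around `β`: near `β` it agrees on `M` with a `C²`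
function of the ambient space. -/
def RestrictionIsC2At (J : E → ℝ) (M : Set E) (β : E) : Prop :=
  ∃ g : E → ℝ, ContDiffAt ℝ 2 g β ∧ ∀ᶠ x in 𝓝[M] β, J x = g x

/-- `J` is partly smooth at `β` relative to `M`. -/
structure PartlySmoothAt (J : E → ℝ) (M : Set E) (β : E) : Prop where
  mem : β ∈ M
  manifold : IsC2ManifoldAt M β
  smooth : RestrictionIsC2At J M β
  sharp : HasTangentSpaceAt M β (tangentModel J β)
  lower_continuous : LowerHemicontinuousWithinAt (subdiff J) M β
  upper_continuous : UpperHemicontinuousWithinAt (subdiff J) M β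

/-- `J` is locally partly smooth at `β` relative to `M`: `M` is a manifold and `J` is partly smooth
relative to `M` at all points of `M` in a neighbourhood of `β ∈ M`. -/
structure LocallyPartlySmoothAt (J : E → ℝ) (M : Set E) (β : E) : Prop where
  mem : β ∈ M
  manifold : ∀ x ∈ M, IsC2ManifoldAt M x
  partlySmooth : ∃ U ∈ 𝓝 β, ∀ x ∈ M ∩ U, PartlySmoothAt J M x

variable [FiniteDimensional ℝ E]

/-- The vector `e_β`, the only element of `P_{T_β}(∂J(β))`; see `projection_eq_modelVector`. -/
def modelVector (J : E → ℝ) (β : E) : E :=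
  (tangentModel J β).starProjection (Classical.epsilon fun η => η ∈ subdiff J β)

theorem projection_eq_modelVector (J : E → ℝ) (β : E) {η : E} (hη : η ∈ subdiff J β) :
    (tangentModel J β).starProjection η = modelVector J β := by
  have h : (Classical.epsilon fun η => η ∈ subdiff J β) ∈ subdiff J β :=
    Classical.epsilon_spec (p := fun η => η ∈ subdiff J β) ⟨η, hη⟩
  rw [modelVector, ← sub_eq_zero, ← map_sub, Submodule.starProjection_apply_eq_zero_iff,
    tangentModel, Submodule.orthogonal_orthogonal]
  exact vsub_mem_vectorSpan ℝ hη h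

/-- `A` restricted to a bijection from the orthogonal complement of its kernel to its range. -/
def corange (A : E →ₗ[ℝ] E) : (LinearMap.ker A)ᗮ →ₗ[ℝ] LinearMap.range A :=
  A.rangeRestrict ∘ₗ (LinearMap.ker A)ᗮ.subtype

theorem corange_bijective (A : E →ₗ[ℝ] E) : Function.Bijective (corange A) := by
  constructor
  · rw [← LinearMap.ker_eq_bot, LinearMap.ker_eq_bot']
    intro x hx
    have hx' : (x : E) ∈ LinearMap.ker A := congrArg Subtype.val hx
    have h0 := Submodule.inner_right_of_mem_orthogonal hx' x.2
    exact Subtype.ext (inner_self_eq_zero.mp h0)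
  · rintro ⟨_, x, rfl⟩
    obtain ⟨y, hy, z, hz, rfl⟩ := (LinearMap.ker A).exists_add_mem_mem_orthogonal x
    refine ⟨⟨z, hz⟩, Subtype.ext ?_⟩
    have : A y = 0 := hy
    simp [corange, this]

/-- The Moore-Penrose pseudo-inverse `A⁺`: project orthogonally onto the range of `A`, then take
the preimage in the orthogonal complement of the kernel of `A`. -/
def pinv (A : E →ₗ[ℝ] E) : E →ₗ[ℝ] E :=
  (LinearMap.ker A)ᗮ.subtype ∘ₗ
    (LinearEquiv.ofBijective (corange A) (corange_bijective A)).symm.toLinearMap ∘ₗ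
      (LinearMap.range A).orthogonalProjectionOnto.toLinearMap

/-- `Γ_T = P_T Γ P_T`. -/
def compress (Γ : E →ₗ[ℝ] E) (T : Submodule ℝ E) : E →ₗ[ℝ] E :=
  T.starProjection.toLinearMap ∘ₗ Γ ∘ₗ T.starProjection.toLinearMap

/-- The linearized pre-certificate `η_Γ = Γ Γ_T⁺ e`, with `T = T_β` and `e = e_β`. -/
def precertificate (J : E → ℝ) (β : E) (Γ : E →ₗ[ℝ] E) : E :=
  Γ (pinv (compress Γ (tangentModel J β)) (modelVector J β))

/-- The generalized irrepresentable conditions: `ker Γ ∩ T = {0}` and `η_Γ ∈ ri(∂J(β))`. -/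
def IrrepresentableCondition (J : E → ℝ) (β : E) (Γ : E →ₗ[ℝ] E) : Prop :=
  LinearMap.ker Γ ⊓ tangentModel J β = ⊥ ∧
    precertificate J β Γ ∈ intrinsicInterior ℝ (subdiff J β)

/-- The objective `E(β, θ)` for `θ = (μ, u, Γ)`, where `μ > 0`. -/
def objective (J : E → ℝ) (μ : ℝ) (u : E) (Γ : E →ₗ[ℝ] E) (β : E) : ℝ :=
  J β + 1 / (2 * μ) * ⟪Γ β, β⟫ - 1 / μ * ⟪β, u⟫ + 1 / (2 * μ) * ⟪pinv Γ u, u⟫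

/-- The set of solutions of the regularized problem with parameters `θ = (μ, u, Γ)`. -/
def solutions (J : E → ℝ) (μ : ℝ) (u : E) (Γ : E →ₗ[ℝ] E) : Set E :=
  {β | ∀ β', objective J μ u Γ β ≤ objective J μ u Γ β'}

end Convex

/-! ### The random regression model -/

section Regression

variable {Ω : Type*} {p : ℕ}

/-- The `n × p` design matrix whose rows are `ξ₀, …, ξ_{n-1}`. -/
def design (ξ : ℕ → Ω → EuclideanSpace ℝ (Fin p)) (n : ℕ) (ω : Ω) :
    Matrix (Fin n) (Fin p) ℝ :=
  Matrix.of fun i j => ξ i ω j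

/-- The observations `y = X β₀ + w`. -/
def observation (ξ : ℕ → Ω → EuclideanSpace ℝ (Fin p)) (w : ℕ → Ω → ℝ)
    (β₀ : EuclideanSpace ℝ (Fin p)) (n : ℕ) (ω : Ω) : EuclideanSpace ℝ (Fin n) :=
  Matrix.toEuclideanLin (design ξ n ω) β₀ + WithLp.toLp 2 (fun i : Fin n => w i ω)

/-- `u = X* y / n`. -/
def empiricalCorrelation (ξ : ℕ → Ω → EuclideanSpace ℝ (Fin p)) (w : ℕ → Ω → ℝ)
    (β₀ : EuclideanSpace ℝ (Fin p)) (n : ℕ) (ω : Ω) : EuclideanSpace ℝ (Fin p) :=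
  (n : ℝ)⁻¹ • Matrix.toEuclideanLin (design ξ n ω)ᵀ (observation ξ w β₀ n ω)

/-- `Γ = X* X / n`, as an operator on `ℝ^p`. -/
def empiricalCovariance (ξ : ℕ → Ω → EuclideanSpace ℝ (Fin p)) (n : ℕ) (ω : Ω) :
    EuclideanSpace ℝ (Fin p) →ₗ[ℝ] EuclideanSpace ℝ (Fin p) :=
  Matrix.toEuclideanLin ((n : ℝ)⁻¹ • ((design ξ n ω)ᵀ * design ξ n ω))

/-- `Γ̃ = E(ξ* ξ)` for a random row `ξ`, as an operator on `ℝ^p`. -/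
def covariance [MeasurableSpace Ω] (P : Measure Ω) (ξ : Ω → EuclideanSpace ℝ (Fin p)) :
    EuclideanSpace ℝ (Fin p) →ₗ[ℝ] EuclideanSpace ℝ (Fin p) :=
  Matrix.toEuclideanLin (Matrix.of fun i j => ∫ ω, ξ ω i * ξ ω j ∂P)

/-- The event that the regularized problem for `n` observations has a unique solution and that
this solution belongs to `M`. -/
def modelSelected (J : EuclideanSpace ℝ (Fin p) → ℝ) (M : Set (EuclideanSpace ℝ (Fin p)))
    (ξ : ℕ → Ω → EuclideanSpace ℝ (Fin p)) (w : ℕ → Ω → ℝ) (β₀ : EuclideanSpace ℝ (Fin p))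
    (μ : ℝ) (n : ℕ) : Set Ω :=
  {ω | ∃ β ∈ M,
    solutions J μ (empiricalCorrelation ξ w β₀ n ω) (empiricalCovariance ξ n ω) = {β}}

/-- The events `A n` hold with probability tending to one. As measurability of `A n` is not part
of the definition, the second clause says that the outer probability of failure tends to zero
(it is equivalent to the first for measurable events). -/
def HoldsWithProbabilityTendingToOne [MeasurableSpace Ω] (P : Measure Ω) (A : ℕ → Set Ω) : Prop :=
  Tendsto (fun n => P (A n)) atTop (𝓝 1) ∧ Tendsto (fun n => P (A n)ᶜ) atTop (𝓝 0)

end Regression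

end PartlySmooth

end

namespace PartlySmooth

/-! ### Tangent spaces of `M`: curves and semicontinuity. -/

section LocalEquations

variable {E : Type*} [NormedAddCommGroup E] [InnerProductSpace ℝ E]
  {M : Set E} {β : E} {m k : ℕ} {F : E → EuclideanSpace ℝ (Fin m)}
  {G : E → EuclideanSpace ℝ (Fin k)}

/-! The core is deterministic: if `μ → 0`, `ε / μ → 0` and `Γ → Γ₀`, then the problem with `u = Γ β₀
+ ε` eventually has a unique solution, and it lies in `M`
(`LocallyPartlySmoothAt.eventually_solutions`). It suffices to argue along ultrafilters, where
bounded families converge.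

Minimize the objective over `M` in a small closed ball around `β₀`. Injectivity of `Γ₀` on `T` gives
quadratic growth along `M`, so the minimizers `β` satisfy `β - β₀ = O(μ)`, and `(β - β₀) / μ`
converges to some `v ∈ T`. The residual `η = (u - Γ β) / μ` then tends to `-Γ₀ v`. Optimality along
`M` makes `η - s` orthogonal to `T_β` for every `s ∈ ∂J(β)`; in the limit, this identifies `-Γ₀ v`
with the pre-certificate, a relative interior point of `∂J(β₀)`.

If `η ∉ ∂J(β)`, a unit vector normal to `T_β` separates the two. By lower continuity of `∂J`, its
limit is a functional maximal over `∂J(β₀)` at a relative interior point, hence lies in `T`, but it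
is also orthogonal to `T`: impossible. So `η ∈ ∂J(β)` and `β` is a global solution. A second
solution would give a unit vector in `ker Γ` normal to `∂J(β)` at `η`; limits of such vectors lie in
`ker Γ₀ ∩ T = {0}`.

For the random model, `ε = X* w / n`. Chebyshev's inequality with fourth moments shows that `Γ_n →
Γ̃` in probability and that `ε = o(μ_n)` in probability, since `n μ_n² → ∞`. -/

theorem IsLocalEquation.apply_eq_zero (hF : IsLocalEquation M β F) (hβ : β ∈ M) : F β = 0 :=
  hF.eventually_mem_iff.self_of_nhds.1 hβ

theorem IsLocalEquation.continuousAt_fderiv (hF : IsLocalEquation M β F) :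
    ContinuousAt (fderiv ℝ F) β :=
  (hF.contDiffAt.fderiv_right (m := 0) (by norm_num)).continuousAt

theorem tendsto_clm_apply {V W α : Type*} [NormedAddCommGroup V] [NormedSpace ℝ V]
    [NormedAddCommGroup W] [NormedSpace ℝ W] {l : Filter α} {A : α → V →L[ℝ] W} {A₀ : V →L[ℝ] W}
    {x : α → V} {x₀ : V} (hA : Tendsto A l (𝓝 A₀)) (hx : Tendsto x l (𝓝 x₀)) :
    Tendsto (fun a => A a (x a)) l (𝓝 (A₀ x₀)) :=
  (isBoundedBilinearMap_apply.continuous.tendsto (A₀, x₀)).comp (hA.prodMk_nhds hx)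

/-- Vectors in the kernel of a surjective map lift to kernels of nearby maps. -/
theorem exists_tendsto_ker {V W α : Type*} [NormedAddCommGroup V] [NormedSpace ℝ V]
    [NormedAddCommGroup W] [NormedSpace ℝ W] [FiniteDimensional ℝ W] {l : Filter α}
    {A : α → V →L[ℝ] W} {A₀ : V →L[ℝ] W} (hA : Tendsto A l (𝓝 A₀))
    (hsurj : Function.Surjective A₀) {t : V} (ht : A₀ t = 0) :
    (∀ᶠ a in l, Function.Surjective (A a)) ∧
      ∃ τ : α → V, Tendsto τ l (𝓝 t) ∧ ∀ᶠ a in l, A a (τ a) = 0 := by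
  have : CompleteSpace W := FiniteDimensional.complete ℝ W
  obtain ⟨R₀, hR₀⟩ := (A₀ : V →ₗ[ℝ] W).exists_rightInverse_of_surjective
    (LinearMap.range_eq_top.2 hsurj)
  set R : W →L[ℝ] V := LinearMap.toContinuousLinearMap (𝕜 := ℝ) R₀
  have hR : A₀ ∘L R = 1 := by
    ext x
    exact LinearMap.congr_fun hR₀ x
  -- Near the identity `A a ∘ R` is invertible, so `R (A a ∘ R)⁻¹` is a right inverse of `A a`;
  -- subtracting its value at `A a t` moves `t` into the kernel.
  have hAR : Tendsto (fun a => A a ∘L R) l (𝓝 1) := by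
    rw [← hR]
    exact ((ContinuousLinearMap.compL ℝ W V W).flip R).continuous.tendsto A₀ |>.comp hA
  have hunit : ∀ᶠ a in l, IsUnit (A a ∘L R) :=
    hAR.eventually (Units.isOpen.mem_nhds (isUnit_one (M := W →L[ℝ] W)))
  refine ⟨?_, fun a => t - R (Ring.inverse (A a ∘L R) (A a t)), ?_, ?_⟩
  · filter_upwards [hunit] with a ha y
    refine ⟨R (Ring.inverse (A a ∘L R) y), ?_⟩
    exact congrArg (fun B : W →L[ℝ] W => B y) (Ring.mul_inverse_cancel _ ha)
  · have hinv : Tendsto (fun a => Ring.inverse (A a ∘L R)) l (𝓝 (Ring.inverse 1)) :=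
      (NormedRing.inverse_continuousAt (1 : (W →L[ℝ] W)ˣ)).tendsto.comp hAR
    have h := (tendsto_const_nhds (x := t)).sub ((R.continuous.tendsto _).comp
      (tendsto_clm_apply hinv (tendsto_clm_apply hA (tendsto_const_nhds (x := t)))))
    rw [ht, map_zero, map_zero, sub_zero] at h
    exact h
  · filter_upwards [hunit] with a ha
    have this : A a (R (Ring.inverse (A a ∘L R) (A a t))) = A a t :=
      congrArg (fun B : W →L[ℝ] W => B (A a t)) (Ring.mul_inverse_cancel _ ha)
    rw [map_sub, this, sub_self]

/-- A local equation around `β` is a local equation around all points near `β`. -/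
theorem IsLocalEquation.eventually (hF : IsLocalEquation M β F) :
    ∀ᶠ x in 𝓝 β, IsLocalEquation M x F := by
  filter_upwards [hF.contDiffAt.eventually (by simp), hF.eventually_mem_iff.eventually_nhds,
    (exists_tendsto_ker hF.continuousAt_fderiv hF.surjective (map_zero _)).1] with x h1 h2 h3
  exact ⟨h1, h3, h2⟩

variable [FiniteDimensional ℝ E]

/-- Every vector in the kernel of a local equation is the velocity of a curve in the manifold. -/
theorem IsLocalEquation.exists_curve (hF : IsLocalEquation M β F) (hβ : β ∈ M) {t : E}
    (ht : fderiv ℝ F β t = 0) :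
    ∃ γ : ℝ → E, γ 0 = β ∧ HasDerivAt γ t 0 ∧ ∀ᶠ s in 𝓝 0, γ s ∈ M := by
  have : CompleteSpace E := FiniteDimensional.complete ℝ E
  have hs : HasStrictFDerivAt F (fderiv ℝ F β) β := hF.contDiffAt.hasStrictFDerivAt (by norm_num)
  have hr : (fderiv ℝ F β).range = ⊤ := LinearMap.range_eq_top.2 hF.surjective
  let t' : (fderiv ℝ F β).ker := ⟨t, ht⟩
  let φ := hs.implicitFunction F (fderiv ℝ F β) hr (F β)
  have hlin : HasDerivAt (fun s : ℝ => s • t') t' 0 := by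
    simpa using (hasDerivAt_id (0 : ℝ)).smul_const t'
  have hφ : HasFDerivAt φ (fderiv ℝ F β).ker.subtypeL ((0 : ℝ) • t') := by
    rw [zero_smul]
    exact (hs.to_implicitFunction hr).hasFDerivAt
  have hγ0 : φ ((0 : ℝ) • t') = β := by
    rw [zero_smul]
    exact hs.implicitFunction_apply_image hr
  have hγ : HasDerivAt (fun s : ℝ => φ (s • t')) t 0 := by
    have h := HasFDerivAt.comp_hasDerivAt (x := (0 : ℝ)) (f := fun s : ℝ => s • t') hφ hlin
    exact h
  refine ⟨fun s => φ (s • t'), hγ0, hγ, ?_⟩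
  have h1 : Tendsto (fun s : ℝ => φ (s • t')) (𝓝 0) (𝓝 β) := by
    have := hγ.continuousAt.tendsto
    rwa [hγ0] at this
  have h2 : Tendsto (fun s : ℝ => (F β, s • t')) (𝓝 0) (𝓝 (F β, 0)) := by
    refine tendsto_const_nhds.prodMk_nhds ?_
    simpa using hlin.continuousAt.tendsto
  filter_upwards [h1.eventually hF.eventually_mem_iff,
    h2.eventually (hs.map_implicitFunction_eq hr)] with s h3 h4
  exact h3.2 (h4.trans (hF.apply_eq_zero hβ))

/-- A curve in `M` with velocity `t` is also killed by `G`, so the chain rule gives the claim. Hence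
kernels of different equations agree. -/
theorem IsLocalEquation.fderiv_eq_zero (hF : IsLocalEquation M β F) (hG : IsLocalEquation M β G)
    (hβ : β ∈ M) {t : E} (ht : fderiv ℝ F β t = 0) : fderiv ℝ G β t = 0 := by
  obtain ⟨γ, hγ0, hγ, hγM⟩ := hF.exists_curve hβ ht
  have hγc : Tendsto γ (𝓝 0) (𝓝 β) := by
    have := hγ.continuousAt.tendsto
    rwa [hγ0] at this
  have hd : HasFDerivAt G (fderiv ℝ G β) (γ 0) := by
    rw [hγ0]
    exact (hG.contDiffAt.differentiableAt (by norm_num)).hasFDerivAt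
  have h1 := hd.comp_hasDerivAt 0 hγ
  have h2 : G ∘ γ =ᶠ[𝓝 0] fun _ => 0 := by
    filter_upwards [hγM, hγc.eventually hG.eventually_mem_iff] with s h3 h4
    exact h4.1 h3
  exact h1.unique ((hasDerivAt_const (0 : ℝ) (0 : EuclideanSpace ℝ (Fin k))).congr_of_eventuallyEq
    h2)

variable {J : E → ℝ}

theorem PartlySmoothAt.exists_curve (h : PartlySmoothAt J M β) {t : E}
    (ht : t ∈ tangentModel J β) :
    ∃ γ : ℝ → E, γ 0 = β ∧ HasDerivAt γ t 0 ∧ ∀ᶠ s in 𝓝 0, γ s ∈ M := by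
  obtain ⟨m, F, hF, hk⟩ := h.sharp
  rw [← hk] at ht
  exact hF.exists_curve h.mem ht

/-- The tangent spaces vary lower semicontinuously along the manifold. -/
theorem LocallyPartlySmoothAt.exists_tendsto_tangent (h : LocallyPartlySmoothAt J M β)
    {α : Type*} {l : Filter α} {x : α → E} (hx : Tendsto x l (𝓝[M] β)) {t : E}
    (ht : t ∈ tangentModel J β) :
    ∃ τ : α → E, Tendsto τ l (𝓝 t) ∧ ∀ᶠ a in l, τ a ∈ tangentModel J (x a) := by
  obtain ⟨U, hU, hps⟩ := h.partlySmooth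
  obtain ⟨m, F, hF, hk⟩ := (hps β ⟨h.mem, mem_of_mem_nhds hU⟩).sharp
  rw [← hk] at ht
  have hx' : Tendsto x l (𝓝 β) := hx.mono_right inf_le_left
  obtain ⟨τ, hτ, hτ0⟩ :=
    (exists_tendsto_ker (hF.continuousAt_fderiv.tendsto.comp hx') hF.surjective ht).2
  refine ⟨τ, hτ, ?_⟩
  filter_upwards [hτ0, hx'.eventually hF.eventually, hx'.eventually hU,
    hx.eventually self_mem_nhdsWithin] with a h1 h2 h3 h4
  -- `T` at `x a` comes with its own equation `G`, while `τ a` lies in the kernel of the fixed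
  -- equation `F`.
  obtain ⟨k, G, hG, hkG⟩ := (hps (x a) ⟨h4, h3⟩).sharp
  rw [← hkG]
  exact h2.fderiv_eq_zero hG h4 h1

end LocalEquations

/-! ### Geometry and lower continuity of the subdifferential. -/

section Subdifferential

variable {E : Type*} [NormedAddCommGroup E] [InnerProductSpace ℝ E]
  {J : E → ℝ} {M : Set E} {β : E}

theorem isClosed_subdiff (J : E → ℝ) (β : E) : IsClosed (subdiff J β) := by
  simp only [subdiff, Set.ofPred_forall]
  exact isClosed_iInter fun x => isClosed_le (by fun_prop) continuous_const

theorem convex_subdiff (J : E → ℝ) (β : E) : Convex ℝ (subdiff J β) := by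
  intro η hη ζ hζ a b ha hb hab x
  have h1 := mul_le_mul_of_nonneg_left (hη x) ha
  have h2 := mul_le_mul_of_nonneg_left (hζ x) hb
  rw [inner_add_left, real_inner_smul_left, real_inner_smul_left]
  obtain rfl : b = 1 - a := by linarith
  linarith

theorem inner_sub_eq_zero_of_mem_tangentModel {s s' t : E} (hs : s ∈ subdiff J β)
    (hs' : s' ∈ subdiff J β) (ht : t ∈ tangentModel J β) : ⟪s - s', t⟫ = 0 :=
  Submodule.inner_right_of_mem_orthogonal (vsub_mem_vectorSpan ℝ hs hs') ht

theorem mem_tangentModel_iff_of_mem {s₀ z : E} (hs₀ : s₀ ∈ subdiff J β) :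
    z ∈ tangentModel J β ↔ ∀ s ∈ subdiff J β, ⟪s - s₀, z⟫ = 0 := by
  refine ⟨fun hz s hs => inner_sub_eq_zero_of_mem_tangentModel hs hs₀ hz, fun h => ?_⟩
  rw [tangentModel, Submodule.mem_orthogonal]
  intro u hu
  rw [vectorSpan_eq_span_vsub_set_right ℝ hs₀] at hu
  induction hu using Submodule.span_induction with
  | mem x hx => obtain ⟨s, hs, rfl⟩ := hx; exact h s hs
  | zero => simp
  | add x y _ _ hx hy => rw [inner_add_left, hx, hy, add_zero]
  | smul a x _ hx => rw [real_inner_smul_left, hx, mul_zero]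

/-- A linear functional that is maximal over `∂J(β)` at a relative interior point is constant. -/
theorem mem_tangentModel_of_intrinsicInterior {η z : E}
    (hη : η ∈ intrinsicInterior ℝ (subdiff J β)) (hz : ∀ s ∈ subdiff J β, ⟪s - η, z⟫ ≤ 0) :
    z ∈ tangentModel J β := by
  have hηC := intrinsicInterior_subset hη
  rw [mem_tangentModel_iff_of_mem hηC]
  intro s hs
  refine le_antisymm (hz s hs) ?_
  obtain ⟨y, hy, rfl⟩ := mem_intrinsicInterior.1 hη
  -- Prolong the segment from `s` to `y` slightly beyond `y`, to a parameter `r < 0`: maximality at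
  -- that point reverses the inequality.
  have hmem : ∀ r : ℝ, AffineMap.lineMap (y : E) s r ∈ affineSpan ℝ (subdiff J β) := fun r =>
    AffineMap.lineMap_mem r y.2 (subset_affineSpan ℝ _ hs)
  let f : ℝ → affineSpan ℝ (subdiff J β) := fun r => ⟨AffineMap.lineMap (y : E) s r, hmem r⟩
  have hf : Continuous f := AffineMap.lineMap_continuous.subtype_mk _
  have hf0 : f 0 = y := Subtype.ext (AffineMap.lineMap_apply_zero _ _)
  have h1 : ∀ᶠ r in 𝓝 (0 : ℝ), f r ∈ interior ((↑) ⁻¹' subdiff J β : Set _) :=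
    hf.continuousAt.eventually (by rw [hf0]; exact isOpen_interior.mem_nhds hy)
  obtain ⟨r, hr, hr0⟩ := ((h1.filter_mono nhdsWithin_le_nhds).and
    (self_mem_nhdsWithin (s := Set.Iio (0 : ℝ)))).exists
  have h2 : AffineMap.lineMap (y : E) s r ∈ subdiff J β :=
    interior_subset (s := ((↑) ⁻¹' subdiff J β : Set (affineSpan ℝ (subdiff J β)))) hr
  have h3 := hz _ h2
  rw [AffineMap.lineMap_apply_module', add_sub_cancel_right, real_inner_smul_left] at h3
  exact nonneg_of_mul_nonpos_right h3 hr0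

/-- Lower hemicontinuity: subgradients at `β` are limits of subgradients at nearby points. -/
theorem exists_tendsto_subdiff [FiniteDimensional ℝ E]
    (h : LowerHemicontinuousWithinAt (subdiff J) M β)
    {α : Type*} {l : Filter α} {x : α → E} (hx : Tendsto x l (𝓝[M] β)) {s : E}
    (hs : s ∈ subdiff J β) :
    ∃ σ : α → E, Tendsto σ l (𝓝 s) ∧ ∀ᶠ a in l, σ a ∈ subdiff J (x a) := by
  have : ProperSpace E := FiniteDimensional.proper_rclike ℝ E
  have hnear : ∀ ε > 0, ∀ᶠ a in l, (subdiff J (x a) ∩ Metric.ball s ε).Nonempty := fun ε hε =>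
    hx.eventually (lowerHemicontinuousWithinAt_iff.1 h _ Metric.isOpen_ball
      ⟨s, hs, Metric.mem_ball_self hε⟩)
  -- `σ a` is a nearest point to `s` in the closed set `∂J(x a)`, with the irrelevant value `0` when
  -- that set is empty.
  have hex : ∀ a, ∃ y, (subdiff J (x a)).Nonempty →
      y ∈ subdiff J (x a) ∧ Metric.infDist s (subdiff J (x a)) = dist s y := by
    intro a
    by_cases hne : (subdiff J (x a)).Nonempty
    · obtain ⟨y, hy, hd⟩ := (isClosed_subdiff J (x a)).exists_infDist_eq_dist hne s
      exact ⟨y, fun _ => ⟨hy, hd⟩⟩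
    · exact ⟨0, fun h => absurd h hne⟩
  choose σ hσ using hex
  refine ⟨σ, Metric.tendsto_nhds.2 fun ε hε => ?_, ?_⟩
  · filter_upwards [hnear ε hε] with a ha
    obtain ⟨y, hy, hyε⟩ := ha
    obtain ⟨-, h2⟩ := hσ a ⟨y, hy⟩
    rw [dist_comm, ← h2]
    refine (Metric.infDist_le_dist_of_mem hy).trans_lt ?_
    rwa [dist_comm]
  · filter_upwards [hnear 1 one_pos] with a ha
    exact (hσ a ha.left).1

end Subdifferential

/-! ### Quadratic part of the objective, growth and optimality along `M`. -/

section Quadratic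

variable {E : Type*} [NormedAddCommGroup E] [InnerProductSpace ℝ E]

/-- A positive operator annihilates the isotropic vectors of its quadratic form. -/
theorem apply_eq_zero_of_inner_self_eq_zero {Γ : E →ₗ[ℝ] E} (hΓ : Γ.IsPositive) {x : E}
    (hx : ⟪Γ x, x⟫ = 0) : Γ x = 0 := by
  by_contra hne
  set y := Γ x with hy
  have hD : 0 ≤ ⟪Γ y, y⟫ := hΓ.inner_nonneg_left y
  have hN : 0 < ⟪y, y⟫ := real_inner_self_pos.2 hne
  set D := ⟪Γ y, y⟫ with hD'
  set N := ⟪y, y⟫ with hN'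
  -- The form at `x - r • y` is `-r (2N - r D)`, negative because `r D = N - r`; the `+ 1` covers `D
  -- = 0`.
  set r := N / (D + 1) with hr
  have hsym : ⟪Γ y, x⟫ = N := by rw [hΓ.isSymmetric y x, ← hy]
  have hr0 : 0 < r := by positivity
  have hrD : r * (D + 1) = N := by rw [hr]; field_simp
  have h : 0 ≤ ⟪Γ (x - r • y), x - r • y⟫ := hΓ.inner_nonneg_left _
  simp only [map_sub, map_smul, inner_sub_left, inner_sub_right, real_inner_smul_left,
    real_inner_smul_right, hsym, ← hy, hx, ← hN', ← hD'] at h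
  have h2 : 0 < r * (2 * N - r * D) := mul_pos hr0 (by nlinarith)
  nlinarith

theorem pinv_apply_apply [FiniteDimensional ℝ E] (A : E →ₗ[ℝ] E) {x : E}
    (hx : x ∈ (LinearMap.ker A)ᗮ) : pinv A (A x) = x := by
  have h1 : (LinearMap.range A).orthogonalProjectionOnto (A x) = corange A ⟨x, hx⟩ :=
    Submodule.orthogonalProjectionOnto_mem_subspace_eq_self (⟨A x, x, rfl⟩ : LinearMap.range A)
  simp only [pinv, LinearMap.comp_apply, ContinuousLinearMap.coe_coe, LinearEquiv.coe_coe, h1]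
  rw [show corange A ⟨x, hx⟩ = LinearEquiv.ofBijective (corange A) (corange_bijective A) ⟨x, hx⟩
    from rfl, LinearEquiv.symm_apply_apply]
  rfl

/-- The negative gradient at `β` of the quadratic part of the objective. -/
noncomputable def residual (μ : ℝ) (u : E) (Γ : E →ₗ[ℝ] E) (β : E) : E := μ⁻¹ • (u - Γ β)

/-- Exact second-order expansion, by symmetry of `Γ`; the pseudo-inverse term is constant and
cancels. -/
theorem objective_sub [FiniteDimensional ℝ E] (J : E → ℝ) {μ : ℝ} (hμ : 0 < μ) (u : E)
    {Γ : E →ₗ[ℝ] E} (hΓ : Γ.IsPositive) (β x : E) :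
    objective J μ u Γ x - objective J μ u Γ β =
      J x - J β - ⟪residual μ u Γ β, x - β⟫ + 1 / (2 * μ) * ⟪Γ (x - β), x - β⟫ := by
  have hsym : ⟪Γ x, β⟫ = ⟪Γ β, x⟫ := by rw [hΓ.isSymmetric x β, real_inner_comm]
  simp only [objective, residual, map_sub, inner_sub_left, inner_sub_right, real_inner_smul_left,
    hsym, real_inner_comm u]
  field_simp
  ring

variable [FiniteDimensional ℝ E] {J : E → ℝ} {M : Set E} {β₀ : E}

/-- Compactness of closed balls; this replaces extraction of subsequences. -/
theorem exists_tendsto_of_eventually_norm_le {α : Type*} (g : Ultrafilter α) {v : α → E} {K : ℝ}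
    (hv : ∀ᶠ a in (g : Filter α), ‖v a‖ ≤ K) : ∃ v₀, Tendsto v g (𝓝 v₀) := by
  have : ProperSpace E := FiniteDimensional.proper_rclike ℝ E
  obtain ⟨v₀, -, h⟩ := (isCompact_closedBall (0 : E) K).ultrafilter_le_nhds (g.map v)
    (le_principal_iff.2 (hv.mono fun a ha => by simpa using ha))
  exact ⟨v₀, h⟩

/-- A positive homogeneous function of degree two grows quadratically. -/
theorem exists_mul_norm_sq_le {q : E → ℝ} (hq : Continuous q)
    (hhom : ∀ (r : ℝ) x, q (r • x) = r ^ 2 * q x) (hpos : ∀ x, x ≠ 0 → 0 < q x) :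
    ∃ c > 0, ∀ x, c * ‖x‖ ^ 2 ≤ q x := by
  have : ProperSpace E := FiniteDimensional.proper_rclike ℝ E
  have hq0 : q 0 = 0 := by simpa using hhom 0 0
  rcases subsingleton_or_nontrivial E with hE | hE
  · exact ⟨1, one_pos, fun x => by rw [Subsingleton.elim x 0]; simp [hq0]⟩
  obtain ⟨z, hz, hmin⟩ := (isCompact_sphere (0 : E) 1).exists_isMinOn
    (NormedSpace.sphere_nonempty.2 zero_le_one) hq.continuousOn
  have hz1 : ‖z‖ = 1 := by simpa using hz
  refine ⟨q z, hpos z (by rintro rfl; simp at hz1), fun x => ?_⟩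
  by_cases hx : x = 0
  · simp [hx, hq0]
  · have hx' : ‖x‖ ≠ 0 := norm_ne_zero_iff.2 hx
    have h1 : q z ≤ q (‖x‖⁻¹ • x) := hmin (by simp [norm_smul, hx'])
    rw [hhom] at h1
    calc q z * ‖x‖ ^ 2 ≤ (‖x‖⁻¹ ^ 2 * q x) * ‖x‖ ^ 2 := by gcongr
      _ = q x := by field_simp

/-- Restricted injectivity of `Γ` on the tangent space gives quadratic growth along `M`. -/
theorem PartlySmoothAt.exists_quadratic_growth (h : PartlySmoothAt J M β₀) {Γ : E →L[ℝ] E}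
    (hΓ : Γ.toLinearMap.IsPositive)
    (hker : LinearMap.ker Γ.toLinearMap ⊓ tangentModel J β₀ = ⊥) :
    ∃ c > 0, ∀ᶠ x in 𝓝[M] β₀, c * ‖x - β₀‖ ^ 2 ≤ ⟪Γ (x - β₀), x - β₀⟫ := by
  obtain ⟨m, F, hF, hk⟩ := h.sharp
  set A := fderiv ℝ F β₀
  -- Adding `‖A x‖ ^ 2` makes the form definite: it vanishes only on `ker Γ ∩ ker A = ker Γ ∩ T`.
  obtain ⟨c, hc, hq⟩ := exists_mul_norm_sq_le (q := fun x => ⟪Γ x, x⟫ + ‖A x‖ ^ 2) (by fun_prop)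
    (fun r x => by
      simp only [map_smul, real_inner_smul_left, real_inner_smul_right, norm_smul,
        Real.norm_eq_abs, mul_pow, sq_abs]
      ring)
    (fun x hx => by
      have h1 : 0 ≤ ⟪Γ x, x⟫ := hΓ.inner_nonneg_left x
      by_contra hle
      have h2 : ⟪Γ x, x⟫ = 0 := by nlinarith [sq_nonneg ‖A x‖]
      have h3 : A x = 0 := norm_eq_zero.1 (pow_eq_zero_iff two_ne_zero |>.1
        (by nlinarith [sq_nonneg ‖A x‖]))
      refine hx ((Submodule.eq_bot_iff _).1 hker x ⟨?_, ?_⟩)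
      · exact apply_eq_zero_of_inner_self_eq_zero hΓ h2
      · rw [← hk]; exact h3)
  refine ⟨c / 2, half_pos hc, ?_⟩
  have hd : HasFDerivAt F A β₀ := (hF.contDiffAt.differentiableAt (by norm_num)).hasFDerivAt
  -- On `M`, `F` vanishes, so `A (x - β₀)` is `o(‖x - β₀‖)` and costs at most half of `c`.
  have ho := hd.isLittleO.bound (c := √(c / 2)) (by positivity)
  filter_upwards [ho.filter_mono nhdsWithin_le_nhds, self_mem_nhdsWithin,
    hF.eventually_mem_iff.filter_mono nhdsWithin_le_nhds] with x h1 h2 h3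
  rw [h3.1 h2, hF.apply_eq_zero h.mem, sub_zero, zero_sub, norm_neg] at h1
  have h4 : ‖A (x - β₀)‖ ^ 2 ≤ c / 2 * ‖x - β₀‖ ^ 2 := by
    calc _ ≤ (√(c / 2) * ‖x - β₀‖) ^ 2 := by gcongr
      _ = _ := by rw [mul_pow, Real.sq_sqrt (by positivity)]
  have h5 : c * ‖x - β₀‖ ^ 2 ≤ ⟪Γ (x - β₀), x - β₀⟫ + ‖A (x - β₀)‖ ^ 2 := hq (x - β₀)
  linarith

theorem continuous_objective (hJ : ConvexOn ℝ Set.univ J) (μ : ℝ) (u : E) (Γ : E →ₗ[ℝ] E) :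
    Continuous (objective J μ u Γ) := by
  have hJc : Continuous J := hJ.locallyLipschitz.continuous
  have hΓ : Continuous Γ := Γ.continuous_of_finiteDimensional
  unfold objective
  fun_prop

/-- In a small closed ball `M` is the zero set of a continuous map, hence closed there. -/
theorem PartlySmoothAt.exists_isCompact_inter (h : PartlySmoothAt J M β₀) :
    ∃ r₀ > 0, ∀ r ≤ r₀, IsCompact (M ∩ Metric.closedBall β₀ r) := by
  have : ProperSpace E := FiniteDimensional.proper_rclike ℝ E
  obtain ⟨m, F, hF, -⟩ := h.sharp
  obtain ⟨r₀, hr₀, hsub⟩ := Metric.nhds_basis_closedBall.mem_iff.1 hF.eventually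
  refine ⟨r₀, hr₀, fun r hr => ?_⟩
  have hball : Metric.closedBall β₀ r ⊆ Metric.closedBall β₀ r₀ :=
    Metric.closedBall_subset_closedBall hr
  have hc : ContinuousOn F (Metric.closedBall β₀ r) := fun x hx =>
    (hsub (hball hx)).contDiffAt.continuousAt.continuousWithinAt
  have heq : M ∩ Metric.closedBall β₀ r = Metric.closedBall β₀ r ∩ F ⁻¹' {0} := by
    rw [Set.inter_comm]
    ext x
    refine and_congr_right fun hx => ?_
    exact (hsub (hball hx)).eventually_mem_iff.self_of_nhds
  rw [heq]
  exact (isCompact_closedBall β₀ r).of_isClosed_subset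
    (hc.preimage_isClosed_of_isClosed Metric.isClosed_closedBall isClosed_singleton)
    Set.inter_subset_left

/-- First-order optimality along the manifold. -/
theorem PartlySmoothAt.inner_residual_sub (h : PartlySmoothAt J M β₀) {μ : ℝ} (hμ : 0 < μ) {u : E}
    {Γ : E →ₗ[ℝ] E} (hΓ : Γ.IsPositive)
    (hmin : ∀ᶠ x in 𝓝[M] β₀, objective J μ u Γ β₀ ≤ objective J μ u Γ x) {t s : E}
    (ht : t ∈ tangentModel J β₀) (hs : s ∈ subdiff J β₀) :
    ⟪residual μ u Γ β₀ - s, t⟫ = 0 := by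
  -- Follow a curve in `M` with velocity `t`. Subgradients `σ r` at `γ r` bound `J (γ r) - J β₀`
  -- from above by `⟪σ r, γ r - β₀⟫`; divide by `r` and let `r → 0`.
  have key : ∀ t ∈ tangentModel J β₀, 0 ≤ ⟪s - residual μ u Γ β₀, t⟫ := by
    intro t ht
    obtain ⟨γ, hγ0, hγ, hγM⟩ := h.exists_curve ht
    have hγc : Tendsto γ (𝓝[>] 0) (𝓝 β₀) := by
      have := hγ.continuousAt.tendsto
      rw [hγ0] at this
      exact this.mono_left nhdsWithin_le_nhds
    have hγ' : Tendsto γ (𝓝[>] 0) (𝓝[M] β₀) :=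
      tendsto_nhdsWithin_iff.2 ⟨hγc, hγM.filter_mono nhdsWithin_le_nhds⟩
    have hslope : Tendsto (fun r : ℝ => r⁻¹ • (γ r - β₀)) (𝓝[>] 0) (𝓝 t) := by
      simpa [hγ0] using hγ.tendsto_slope_zero_right
    obtain ⟨σ, hσ, hσC⟩ := exists_tendsto_subdiff h.lower_continuous hγ' hs
    have hΓc : Continuous Γ := Γ.continuous_of_finiteDimensional
    have hlim : Tendsto (fun r : ℝ => ⟪σ r - residual μ u Γ β₀, r⁻¹ • (γ r - β₀)⟫ +
        1 / (2 * μ) * ⟪Γ (γ r - β₀), r⁻¹ • (γ r - β₀)⟫) (𝓝[>] 0)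
        (𝓝 (⟪s - residual μ u Γ β₀, t⟫ + 1 / (2 * μ) * ⟪Γ (β₀ - β₀), t⟫)) :=
      ((hσ.sub_const _).inner hslope).add ((((hΓc.tendsto _).comp (hγc.sub_const β₀)).inner
        hslope).const_mul _)
    rw [sub_self, map_zero, inner_zero_left, mul_zero, add_zero] at hlim
    refine ge_of_tendsto hlim ?_
    filter_upwards [hσC, hγ'.eventually hmin, self_mem_nhdsWithin] with r h1 h2 h3
    have h4 := objective_sub J hμ u hΓ β₀ (γ r)
    have h5 := h1 β₀
    rw [← neg_sub, inner_neg_right] at h5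
    have h6 : 0 < r⁻¹ := inv_pos.2 h3
    rw [real_inner_smul_right, real_inner_smul_right, inner_sub_left]
    have h7 : 0 ≤ ⟪σ r, γ r - β₀⟫ - ⟪residual μ u Γ β₀, γ r - β₀⟫ +
        1 / (2 * μ) * ⟪Γ (γ r - β₀), γ r - β₀⟫ := by linarith
    calc 0 ≤ r⁻¹ * (⟪σ r, γ r - β₀⟫ - ⟪residual μ u Γ β₀, γ r - β₀⟫ +
        1 / (2 * μ) * ⟪Γ (γ r - β₀), γ r - β₀⟫) := mul_nonneg h6.le h7
      _ = _ := by ring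
  have h1 := key t ht
  have h2 := key (-t) (neg_mem ht)
  rw [inner_neg_right] at h2
  rw [← neg_sub, inner_neg_left]
  linarith

end Quadratic

/-! ### Deterministic model identification. -/

section Identification

variable {E : Type*} [NormedAddCommGroup E] [InnerProductSpace ℝ E] [FiniteDimensional ℝ E]
  {J : E → ℝ} {M : Set E} {β₀ : E}

/-- The problem restricted to `M` near `β₀` has local minimizers, at distance `O(μ)` of `β₀`. -/
theorem PartlySmoothAt.exists_local_minimizers (hJ : ConvexOn ℝ Set.univ J)
    (h : PartlySmoothAt J M β₀) {Γ₀ : E →L[ℝ] E} (hΓ₀ : Γ₀.toLinearMap.IsPositive)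
    (hker : LinearMap.ker Γ₀.toLinearMap ⊓ tangentModel J β₀ = ⊥)
    (hne : (subdiff J β₀).Nonempty) {α : Type*} {l : Filter α} {μ : α → ℝ} {ε : α → E}
    {Γ : α → E →L[ℝ] E} (hμ : ∀ᶠ a in l, 0 < μ a) (hμ0 : Tendsto μ l (𝓝 0))
    (hε : Tendsto (fun a => (μ a)⁻¹ • ε a) l (𝓝 0)) (hΓ : Tendsto Γ l (𝓝 Γ₀))
    (hpos : ∀ᶠ a in l, (Γ a).toLinearMap.IsPositive) :
    ∃ (β : α → E) (K : ℝ), ∀ᶠ a in l, β a ∈ M ∧ ‖(μ a)⁻¹ • (β a - β₀)‖ ≤ K ∧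
      ∀ᶠ x in 𝓝[M] β a, objective J (μ a) (Γ a β₀ + ε a) (Γ a).toLinearMap (β a) ≤
        objective J (μ a) (Γ a β₀ + ε a) (Γ a).toLinearMap x := by
  obtain ⟨s₀, hs₀⟩ := hne
  obtain ⟨r₀, hr₀, hcomp⟩ := h.exists_isCompact_inter
  obtain ⟨c, hc, hgrow⟩ := h.exists_quadratic_growth hΓ₀ hker
  obtain ⟨r₁, hr₁, hgrow'⟩ := 
    (nhdsWithin_hasBasis Metric.nhds_basis_closedBall M).mem_iff.1 hgrow
  set r := min r₀ r₁ with hr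
  have hr0 : 0 < r := lt_min hr₀ hr₁
  have hmin : ∀ a, ∃ b ∈ M ∩ Metric.closedBall β₀ r,
      IsMinOn (objective J (μ a) (Γ a β₀ + ε a) (Γ a).toLinearMap)
        (M ∩ Metric.closedBall β₀ r) b := fun a =>
    (hcomp r (min_le_left _ _)).exists_isMinOn ⟨β₀, h.mem, Metric.mem_closedBall_self hr0.le⟩
      (continuous_objective hJ _ _ _).continuousOn
  choose β hβ hβmin using hmin
  -- Comparison with `β₀` gives `(c / 2) ‖d‖² ≤ ⟪Γ d, d⟫ ≤ 2 μ (1 + ‖s₀‖) ‖d‖`, once `‖Γ - Γ₀‖ < c /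
  -- 2` and `‖ε / μ‖ < 1`.
  set K := 4 * (1 + ‖s₀‖) / c with hK
  have hK0 : 0 < K := by positivity
  refine ⟨β, K, ?_⟩
  have hε1 : ∀ᶠ a in l, ‖(μ a)⁻¹ • ε a‖ < 1 := by
    have := hε.norm
    rw [norm_zero] at this
    exact this.eventually (gt_mem_nhds one_pos)
  have hΓ1 : ∀ᶠ a in l, ‖Γ a - Γ₀‖ < c / 2 := by
    have := (hΓ.sub_const Γ₀).norm
    rw [sub_self, norm_zero] at this
    exact this.eventually (gt_mem_nhds (half_pos hc))
  -- This puts the minimizer in the open ball, so it is a local minimizer on all of `M`.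
  have hμ1 : ∀ᶠ a in l, μ a < r / K := hμ0.eventually (gt_mem_nhds (by positivity))
  filter_upwards [hμ, hpos, hε1, hΓ1, hμ1] with a ha hpa hεa hΓa hμa
  set d := β a - β₀ with hd
  have h1 : objective J (μ a) (Γ a β₀ + ε a) (Γ a).toLinearMap (β a) ≤
      objective J (μ a) (Γ a β₀ + ε a) (Γ a).toLinearMap β₀ :=
    hβmin a ⟨h.mem, Metric.mem_closedBall_self hr0.le⟩
  have h2 := objective_sub J ha (Γ a β₀ + ε a) hpa β₀ (β a)
  have h3 : residual (μ a) (Γ a β₀ + ε a) (Γ a).toLinearMap β₀ = (μ a)⁻¹ • ε a := by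
    simp [residual]
  rw [h3, ← hd] at h2
  have h4 : J β₀ + ⟪s₀, d⟫ ≤ J (β a) := hs₀ (β a)
  have h5 : c * ‖d‖ ^ 2 ≤ ⟪Γ₀ d, d⟫ := hgrow' ⟨Metric.closedBall_subset_closedBall
    (min_le_right _ _) (hβ a).2, (hβ a).1⟩
  have h6 : ⟪(Γ₀ - Γ a) d, d⟫ ≤ c / 2 * ‖d‖ ^ 2 := by
    calc ⟪(Γ₀ - Γ a) d, d⟫ ≤ ‖(Γ₀ - Γ a) d‖ * ‖d‖ := real_inner_le_norm _ _
      _ ≤ (‖Γ₀ - Γ a‖ * ‖d‖) * ‖d‖ := by gcongr; exact (Γ₀ - Γ a).le_opNorm d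
      _ ≤ (c / 2 * ‖d‖) * ‖d‖ := by gcongr; rw [norm_sub_rev]; exact hΓa.le
      _ = _ := by ring
  rw [sub_apply, inner_sub_left] at h6
  have h7 : ⟪(μ a)⁻¹ • ε a - s₀, d⟫ ≤ (1 + ‖s₀‖) * ‖d‖ :=
    (real_inner_le_norm _ _).trans (by
      gcongr
      exact (norm_sub_le _ _).trans (by gcongr))
  rw [inner_sub_left] at h7
  have h8 : ‖d‖ ≤ K * μ a := by
    have h9 : 1 / (2 * μ a) * ⟪Γ a d, d⟫ ≤ (1 + ‖s₀‖) * ‖d‖ := by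
      have : (Γ a).toLinearMap d = Γ a d := rfl
      rw [this] at h2
      linarith
    have h10 : ⟪Γ a d, d⟫ ≤ (1 + ‖s₀‖) * ‖d‖ * (2 * μ a) := by
      rwa [one_div, inv_mul_le_iff₀ (by positivity), mul_comm] at h9
    have h11 : ‖d‖ * (c * ‖d‖) ≤ ‖d‖ * (4 * (1 + ‖s₀‖) * μ a) := by nlinarith
    rcases (norm_nonneg d).eq_or_lt with h0 | h0
    · rw [← h0]; positivity
    · have := le_of_mul_le_mul_left h11 h0
      rw [hK, div_mul_eq_mul_div, le_div_iff₀ hc]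
      linarith
  refine ⟨(hβ a).1, ?_, ?_⟩
  · rw [norm_smul, norm_inv, Real.norm_of_nonneg ha.le, inv_mul_le_iff₀ ha, mul_comm]
    exact h8
  · have h9 : Metric.closedBall β₀ r ∈ 𝓝 (β a) := by
      refine Metric.closedBall_mem_nhds_of_mem ?_
      rw [Metric.mem_ball, dist_eq_norm, ← hd]
      calc ‖d‖ ≤ K * μ a := h8
        _ < K * (r / K) := by gcongr
        _ = r := by field_simp
    filter_upwards [self_mem_nhdsWithin, nhdsWithin_le_nhds h9] with x hx1 hx2
    exact hβmin a ⟨hx1, hx2⟩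

/-- The limit of the rescaled errors identifies the limit of the residuals. -/
theorem map_neg_eq_precertificate {Γ : E →ₗ[ℝ] E} (hΓ : Γ.IsPositive)
    (hker : LinearMap.ker Γ ⊓ tangentModel J β₀ = ⊥) {v s₀ : E} (hv : v ∈ tangentModel J β₀)
    (hs₀ : s₀ ∈ subdiff J β₀) (hopt : ∀ t ∈ tangentModel J β₀, ⟪Γ v - s₀, t⟫ = 0) :
    precertificate J β₀ Γ = Γ v := by
  set T := tangentModel J β₀ with hT
  have hPv : T.starProjection v = v := Submodule.starProjection_eq_self_iff.2 hv
  have h1 : compress Γ T v = modelVector J β₀ := by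
    rw [← projection_eq_modelVector J β₀ hs₀]
    simp only [compress, LinearMap.comp_apply, ContinuousLinearMap.coe_coe, hPv]
    rw [← sub_eq_zero, ← map_sub, Submodule.starProjection_apply_eq_zero_iff,
      Submodule.mem_orthogonal']
    exact hopt
  -- The kernel of the compression is orthogonal to `T`: a vector `k` in it has `P_T k` isotropic
  -- for `Γ`, hence in `ker Γ ∩ T`.
  have h2 : v ∈ (LinearMap.ker (compress Γ T))ᗮ := by
    rw [Submodule.mem_orthogonal]
    intro k hk
    have h3 : T.starProjection (Γ (T.starProjection k)) = 0 := hk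
    have h4 : ⟪Γ (T.starProjection k), T.starProjection k⟫ = 0 := by
      have := (Submodule.starProjection_apply_eq_zero_iff _).1 h3
      exact (Submodule.mem_orthogonal' _ _).1 this _ (Submodule.starProjection_apply_mem _ _)
    have h5 : T.starProjection k = 0 := (Submodule.eq_bot_iff _).1 hker _
      ⟨apply_eq_zero_of_inner_self_eq_zero hΓ h4, Submodule.starProjection_apply_mem _ _⟩
    exact (Submodule.mem_orthogonal' _ _).1
      ((Submodule.starProjection_apply_eq_zero_iff _).1 h5) v hv
  rw [precertificate, ← hT, ← h1, pinv_apply_apply _ h2]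

/-- A point of the affine hull of `∂J(β)` outside `∂J(β)` is separated from it. -/
theorem exists_separating_of_notMem {η : E} {β : E} (hne : (subdiff J β).Nonempty)
    (hη : η ∉ subdiff J β)
    (haff : ∀ s ∈ subdiff J β, ∀ t ∈ tangentModel J β, ⟪η - s, t⟫ = 0) :
    ∃ z, ‖z‖ = 1 ∧ (∀ s ∈ subdiff J β, ⟪s - η, z⟫ ≤ 0) ∧
      ∀ t ∈ tangentModel J β, ⟪z, t⟫ = 0 := by
  have : CompleteSpace E := FiniteDimensional.complete ℝ E
  -- The separating direction is the normalized `η - π`, with `π` the projection of `η` onto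
  -- `∂J(β)`.
  obtain ⟨π, hπ, hd⟩ := exists_norm_eq_iInf_of_complete_convex hne
    (isClosed_subdiff J β).isComplete (convex_subdiff J β) η
  rw [norm_eq_iInf_iff_real_inner_le_zero (convex_subdiff J β) hπ] at hd
  have h0 : η - π ≠ 0 := fun h => hη (by rwa [sub_eq_zero.1 h])
  have h0' : 0 < ‖η - π‖ := norm_pos_iff.2 h0
  refine ⟨‖η - π‖⁻¹ • (η - π), norm_smul_inv_norm h0, fun s hs => ?_, fun t ht => ?_⟩
  · rw [real_inner_smul_right]
    refine mul_nonpos_of_nonneg_of_nonpos (by positivity) ?_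
    have h1 := hd s hs
    have h2 : s - η = (s - π) - (η - π) := by abel
    rw [h2, inner_sub_left, real_inner_comm]
    linarith [real_inner_self_nonneg (x := η - π)]
  · rw [real_inner_smul_left, haff π hπ t ht, mul_zero]

/-- If the residual is a subgradient at `β` and no direction in the kernel of `Γ` is normal to the
subdifferential there, then `β` is the only solution. -/
theorem solutions_eq_singleton {μ : ℝ} (hμ : 0 < μ) {u : E} {Γ : E →ₗ[ℝ] E} (hΓ : Γ.IsPositive)
    {β : E} (hβ : residual μ u Γ β ∈ subdiff J β)
    (hker : ∀ z, ‖z‖ = 1 → (∀ s ∈ subdiff J β, ⟪s - residual μ u Γ β, z⟫ ≤ 0) → Γ z ≠ 0) :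
    solutions J μ u Γ = {β} := by
  ext x
  simp only [solutions, Set.mem_ofPred_eq, Set.mem_singleton_iff]
  constructor
  · intro hx
    by_contra hne
    have h1 := hx β
    have h2 := objective_sub J hμ u hΓ β x
    have h3 := hβ x
    have h4 : 0 ≤ ⟪Γ (x - β), x - β⟫ := hΓ.inner_nonneg_left _
    have h5 : 0 < 1 / (2 * μ) := by positivity
    -- The subgradient gap and the quadratic term are nonnegative with sum at most `0`, so both
    -- vanish.
    have h6 : ⟪Γ (x - β), x - β⟫ = 0 := by
      refine le_antisymm ?_ h4
      by_contra hlt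
      have := mul_pos h5 (not_le.1 hlt)
      linarith
    have h0 : x - β ≠ 0 := sub_ne_zero.2 hne
    refine hker (‖x - β‖⁻¹ • (x - β)) (norm_smul_inv_norm h0) (fun s hs => ?_) ?_
    · rw [real_inner_smul_right, inner_sub_left]
      refine mul_nonpos_of_nonneg_of_nonpos (by positivity) ?_
      have h7 := hs x
      rw [h6] at h2
      linarith
    · rw [map_smul, apply_eq_zero_of_inner_self_eq_zero hΓ h6, smul_zero]
  · rintro rfl x'
    have h2 := objective_sub J hμ u hΓ x x'
    have h3 := hβ x'
    have h4 : 0 ≤ 1 / (2 * μ) * ⟪Γ (x' - x), x' - x⟫ :=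
      mul_nonneg (by positivity) (hΓ.inner_nonneg_left _)
    linarith

/-- A relative interior certificate admits no nontrivial limits of normal directions off the
tangent space. -/
theorem PartlySmoothAt.mem_tangentModel_of_tendsto (h : PartlySmoothAt J M β₀) {α : Type*}
    {l : Filter α} [l.NeBot] {β η z : α → E} {η₀ z₀ : E} (hβ : Tendsto β l (𝓝[M] β₀))
    (hη : Tendsto η l (𝓝 η₀)) (hη₀ : η₀ ∈ intrinsicInterior ℝ (subdiff J β₀))
    (hz : Tendsto z l (𝓝 z₀)) (hnormal : ∀ᶠ a in l, ∀ s ∈ subdiff J (β a), ⟪s - η a, z a⟫ ≤ 0) :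
    z₀ ∈ tangentModel J β₀ := by
  refine mem_tangentModel_of_intrinsicInterior hη₀ fun s hs => ?_
  obtain ⟨σ, hσ, hσC⟩ := exists_tendsto_subdiff h.lower_continuous hβ hs
  refine le_of_tendsto ((hσ.sub hη).inner hz) ?_
  filter_upwards [hσC, hnormal] with a h1 h2
  exact h2 _ h1

/-- Model selection along an ultrafilter of vanishing perturbations. -/
theorem LocallyPartlySmoothAt.eventually_solutions_ultrafilter (hJ : ConvexOn ℝ Set.univ J)
    (h : LocallyPartlySmoothAt J M β₀) {Γ₀ : E →L[ℝ] E} (hΓ₀ : Γ₀.toLinearMap.IsPositive)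
    (hirr : IrrepresentableCondition J β₀ Γ₀.toLinearMap)
    {α : Type*} (g : Ultrafilter α) {μ : α → ℝ} {ε : α → E}
    {Γ : α → E →L[ℝ] E} (hμ : ∀ᶠ a in (g : Filter α), 0 < μ a) (hμ0 : Tendsto μ g (𝓝 0))
    (hε : Tendsto (fun a => (μ a)⁻¹ • ε a) g (𝓝 0)) (hΓ : Tendsto Γ g (𝓝 Γ₀))
    (hpos : ∀ᶠ a in (g : Filter α), (Γ a).toLinearMap.IsPositive) :
    ∀ᶠ a in (g : Filter α), ∃ β ∈ M,
      solutions J (μ a) (Γ a β₀ + ε a) (Γ a).toLinearMap = {β} := by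
  obtain ⟨hker, hri⟩ := hirr
  obtain ⟨U, hU, hps⟩ := h.partlySmooth
  have h₀ : PartlySmoothAt J M β₀ := hps β₀ ⟨h.mem, mem_of_mem_nhds hU⟩
  have hs₀ := intrinsicInterior_subset hri
  set s₀ := precertificate J β₀ Γ₀.toLinearMap with hs₀_def
  obtain ⟨β, K, hβ⟩ := h₀.exists_local_minimizers hJ hΓ₀ hker ⟨s₀, hs₀⟩ hμ hμ0 hε hΓ hpos
  have hβM : ∀ᶠ a in (g : Filter α), β a ∈ M := hβ.mono fun a ha => ha.1
  obtain ⟨v, hv⟩ := exists_tendsto_of_eventually_norm_le g (hβ.mono fun a ha => ha.2.1)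
  have hd : Tendsto (fun a => β a - β₀) g (𝓝 0) := by
    have h1 := hμ0.smul hv
    rw [zero_smul] at h1
    refine h1.congr' ?_
    filter_upwards [hμ] with a ha
    rw [smul_inv_smul₀ ha.ne']
  have hβ₀ : Tendsto β g (𝓝 β₀) := by simpa using hd.add_const β₀
  have hβ' : Tendsto β g (𝓝[M] β₀) := tendsto_nhdsWithin_iff.2 ⟨hβ₀, hβM⟩
  -- `F` vanishes at `β a` and at `β₀`, so its derivative kills the limit of the rescaled
  -- increments.
  have hvT : v ∈ tangentModel J β₀ := by
    obtain ⟨m, F, hF, hk⟩ := h₀.sharp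
    rw [← hk]
    have hFd : HasFDerivAt F (fderiv ℝ F β₀) β₀ :=
      (hF.contDiffAt.differentiableAt (by norm_num)).hasFDerivAt
    have h1 := (hasFDerivWithinAt_univ.2 hFd).lim hd (.of_forall fun _ => Set.mem_univ _) hv
    refine tendsto_nhds_unique (h1.congr' ?_) tendsto_const_nhds
    filter_upwards [hβM, hβ₀.eventually hF.eventually_mem_iff] with a h2 h3
    rw [add_sub_cancel, h3.1 h2, hF.apply_eq_zero h₀.mem, sub_zero, smul_zero]
  set η : α → E := fun a => residual (μ a) (Γ a β₀ + ε a) (Γ a).toLinearMap (β a) with hη_def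
  -- The residual equals `ε / μ - Γ ((β - β₀) / μ)`.
  have hη : Tendsto η g (𝓝 (Γ₀ (-v))) := by
    have h1 := hε.sub (tendsto_clm_apply hΓ hv)
    rw [zero_sub, ← map_neg] at h1
    refine h1.congr fun a => ?_
    simp only [hη_def, residual, ContinuousLinearMap.coe_coe, map_smul, map_sub, ← smul_sub]
    congr 1
    abel
  have hfirst : ∀ᶠ a in (g : Filter α), ∀ s ∈ subdiff J (β a), ∀ t ∈ tangentModel J (β a),
      ⟪η a - s, t⟫ = 0 := by
    filter_upwards [hβ, hβ₀.eventually hU, hμ, hpos] with a h1 h2 h3 h4 s hs t ht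
    exact (hps (β a) ⟨h1.1, h2⟩).inner_residual_sub h3 h4 h1.2.2 ht hs
  obtain ⟨σ, hσ, hσC⟩ := exists_tendsto_subdiff h₀.lower_continuous hβ' hs₀
  have hlim : precertificate J β₀ Γ₀.toLinearMap = Γ₀ (-v) := by
    refine map_neg_eq_precertificate hΓ₀ hker (neg_mem hvT) hs₀ fun t ht => ?_
    obtain ⟨τ, hτ, hτT⟩ := h.exists_tendsto_tangent hβ' ht
    refine tendsto_nhds_unique (((hη.sub hσ).inner hτ).congr' ?_) tendsto_const_nhds
    filter_upwards [hfirst, hσC, hτT] with a h1 h2 h3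
    exact h1 _ h2 _ h3
  rw [← hlim] at hη
  have hmem : ∀ᶠ a in (g : Filter α), η a ∈ subdiff J (β a) := by
    by_contra hnot
    rw [← Ultrafilter.eventually_not] at hnot
    have hex : ∀ a, ∃ z, (η a ∉ subdiff J (β a) ∧ (subdiff J (β a)).Nonempty ∧
        ∀ s ∈ subdiff J (β a), ∀ t ∈ tangentModel J (β a), ⟪η a - s, t⟫ = 0) →
        ‖z‖ = 1 ∧ (∀ s ∈ subdiff J (β a), ⟪s - η a, z⟫ ≤ 0) ∧
          ∀ t ∈ tangentModel J (β a), ⟪z, t⟫ = 0 := by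
      intro a
      by_cases hP : η a ∉ subdiff J (β a) ∧ (subdiff J (β a)).Nonempty ∧
        ∀ s ∈ subdiff J (β a), ∀ t ∈ tangentModel J (β a), ⟪η a - s, t⟫ = 0
      · obtain ⟨z, hz⟩ := exists_separating_of_notMem hP.2.1 hP.1 hP.2.2
        exact ⟨z, fun _ => hz⟩
      · exact ⟨0, fun hP' => absurd hP' hP⟩
    choose z hz using hex
    have hz' : ∀ᶠ a in (g : Filter α), ‖z a‖ = 1 ∧ (∀ s ∈ subdiff J (β a), ⟪s - η a, z a⟫ ≤ 0) ∧
        ∀ t ∈ tangentModel J (β a), ⟪z a, t⟫ = 0 := by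
      filter_upwards [hnot, hσC, hfirst] with a h1 h2 h3
      exact hz a ⟨h1, ⟨_, h2⟩, h3⟩
    obtain ⟨z₀, hz₀⟩ := exists_tendsto_of_eventually_norm_le g (hz'.mono fun a ha => ha.1.le)
    have hz₀1 : ‖z₀‖ = 1 :=
      tendsto_nhds_unique (hz₀.norm.congr' (hz'.mono fun a ha => ha.1)) tendsto_const_nhds
    have hz₀T := h₀.mem_tangentModel_of_tendsto hβ' hη hri hz₀ (hz'.mono fun a ha => ha.2.1)
    obtain ⟨τ, hτ, hτT⟩ := h.exists_tendsto_tangent hβ' hz₀T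
    -- `z₀ ∈ T` is a limit of `τ a ∈ T_β`, to which `z a` is orthogonal.
    have h1 : ⟪z₀, z₀⟫ = 0 := by
      refine tendsto_nhds_unique ((hz₀.inner hτ).congr' ?_) tendsto_const_nhds
      filter_upwards [hz', hτT] with a h2 h3
      exact h2.2.2 _ h3
    rw [inner_self_eq_zero.1 h1, norm_zero] at hz₀1
    exact zero_ne_one hz₀1
  have huniq : ∀ᶠ a in (g : Filter α), ∀ z, ‖z‖ = 1 →
      (∀ s ∈ subdiff J (β a), ⟪s - η a, z⟫ ≤ 0) → Γ a z ≠ 0 := by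
    by_contra hnot
    rw [← Ultrafilter.eventually_not] at hnot
    push Not at hnot
    obtain ⟨z, hz⟩ := hnot.choice
    obtain ⟨z₀, hz₀⟩ := exists_tendsto_of_eventually_norm_le g (hz.mono fun a ha => ha.1.le)
    have hz₀1 : ‖z₀‖ = 1 :=
      tendsto_nhds_unique (hz₀.norm.congr' (hz.mono fun a ha => ha.1)) tendsto_const_nhds
    have hz₀T := h₀.mem_tangentModel_of_tendsto hβ' hη hri hz₀ (hz.mono fun a ha => ha.2.1)
    have h1 : Γ₀ z₀ = 0 := tendsto_nhds_unique
      ((tendsto_clm_apply hΓ hz₀).congr' (hz.mono fun a ha => ha.2.2)) tendsto_const_nhds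
    rw [(Submodule.eq_bot_iff _).1 hker z₀ ⟨h1, hz₀T⟩, norm_zero] at hz₀1
    exact zero_ne_one hz₀1
  filter_upwards [hβM, hμ, hpos, hmem, huniq] with a h1 h2 h3 h4 h5
  exact ⟨β a, h1, solutions_eq_singleton h2 h3 h4 h5⟩

/-- Model selection holds for all small perturbations of the parameters. -/
theorem LocallyPartlySmoothAt.eventually_solutions (hJ : ConvexOn ℝ Set.univ J)
    (h : LocallyPartlySmoothAt J M β₀) {Γ₀ : E →L[ℝ] E} (hΓ₀ : Γ₀.toLinearMap.IsPositive)
    (hirr : IrrepresentableCondition J β₀ Γ₀.toLinearMap)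
    {α : Type*} {l : Filter α} {μ : α → ℝ} {ε : α → E}
    {Γ : α → E →L[ℝ] E} (hμ : ∀ᶠ a in l, 0 < μ a) (hμ0 : Tendsto μ l (𝓝 0))
    (hε : Tendsto (fun a => (μ a)⁻¹ • ε a) l (𝓝 0)) (hΓ : Tendsto Γ l (𝓝 Γ₀))
    (hpos : ∀ᶠ a in l, (Γ a).toLinearMap.IsPositive) :
    ∀ᶠ a in l, ∃ β ∈ M, solutions J (μ a) (Γ a β₀ + ε a) (Γ a).toLinearMap = {β} :=
  -- A set belongs to a filter as soon as it belongs to every finer ultrafilter.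
  mem_iff_ultrafilter.2 fun g hg => h.eventually_solutions_ultrafilter hJ hΓ₀ hirr g
    (hμ.filter_mono hg) (hμ0.mono_left hg) (hε.mono_left hg) (hΓ.mono_left hg)
    (hpos.filter_mono hg)

end Identification

/-! ### Chebyshev bounds and events of vanishing probability. -/

section Averages

variable {Ω : Type*} [MeasurableSpace Ω] {P : Measure Ω}

/-- Chebyshev's inequality for averages of i.i.d. square integrable variables. -/
theorem measure_average_deviation_le [IsProbabilityMeasure P] {Z : ℕ → Ω → ℝ}
    (hZ : ∀ i, MemLp (Z i) 2 P) (hind : Pairwise fun i j => IndepFun (Z i) (Z j) P)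
    (hid : ∀ i, IdentDistrib (Z i) (Z 0) P P) {n : ℕ} (hn : 0 < n) {c : ℝ} (hc : 0 < c) :
    P {ω | c ≤ |(n : ℝ)⁻¹ * ∑ i : Fin n, Z i ω - ∫ ω, Z 0 ω ∂P|} ≤
      ENNReal.ofReal (variance (Z 0) P / (n * c ^ 2)) := by
  have hn' : (0 : ℝ) < n := Nat.cast_pos.2 hn
  set S : Ω → ℝ := ∑ i ∈ Finset.range n, Z i with hS
  have hSmem : MemLp S 2 P := memLp_finsetSum' _ fun i _ => hZ i
  have hvar : variance S P = n * variance (Z 0) P := by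
    rw [hS, IndepFun.variance_sum (fun i _ => hZ i) fun i _ j _ hij => hind hij,
      Finset.sum_congr rfl fun i _ => (hid i).variance_eq]
    simp
  have hint : ∫ ω, S ω ∂P = n * ∫ ω, Z 0 ω ∂P := by
    simp only [hS, Finset.sum_apply]
    rw [integral_finsetSum _ fun i _ => (hZ i).integrable one_le_two,
      Finset.sum_congr rfl fun i _ => (hid i).integral_eq]
    simp
  have h := meas_ge_le_variance_div_sq hSmem (c := n * c) (by positivity)
  rw [hvar, hint] at h
  convert h using 2
  · ext ω
    simp only [Set.mem_ofPred_eq]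
    have h1 : S ω = ∑ i : Fin n, Z i ω := by
      rw [hS, Finset.sum_apply, Finset.sum_range]
    have h2 : S ω - n * ∫ ω, Z 0 ω ∂P =
        n * ((n : ℝ)⁻¹ * ∑ i : Fin n, Z i ω - ∫ ω, Z 0 ω ∂P) := by
      rw [h1]
      field_simp
    rw [h2, abs_mul, abs_of_pos hn', mul_le_mul_iff_right₀ hn']
  · field_simp

/-- Letting `c` depend on `n` covers both the law of large numbers (`c` constant) and the noise rate
(`c n = δ * μ n`). -/
theorem tendsto_measure_average_deviation [IsProbabilityMeasure P] {Z : ℕ → Ω → ℝ}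
    (hZ : ∀ i, MemLp (Z i) 2 P)
    (hind : Pairwise fun i j => IndepFun (Z i) (Z j) P)
    (hid : ∀ i, IdentDistrib (Z i) (Z 0) P P) {c : ℕ → ℝ} (hc : ∀ n, 0 < c n)
    (hc' : Tendsto (fun n : ℕ => n * c n ^ 2) atTop atTop) :
    Tendsto (fun n : ℕ => P {ω | c n ≤ |(n : ℝ)⁻¹ * ∑ i : Fin n, Z i ω - ∫ ω, Z 0 ω ∂P|})
      atTop (𝓝 0) := by
  have h1 : Tendsto (fun n : ℕ => ENNReal.ofReal (variance (Z 0) P / (n * c n ^ 2)))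
      atTop (𝓝 0) := by
    rw [← ENNReal.ofReal_zero]
    exact (ENNReal.continuous_ofReal.tendsto 0).comp (hc'.const_div_atTop _)
  refine tendsto_of_tendsto_of_tendsto_of_le_of_le' tendsto_const_nhds h1
    (.of_forall fun _ => zero_le) ?_
  filter_upwards [eventually_gt_atTop 0] with n hn
  exact measure_average_deviation_le hZ hind hid hn (hc n)

theorem tendsto_mul_sq_of_inv_isLittleO {μ : ℕ → ℝ} (hμ_pos : ∀ n, 0 < μ n)
    (hμ_inv : (fun n => (μ n)⁻¹) =o[atTop] (fun n : ℕ => (n : ℝ) ^ (1 / 2 : ℝ))) {δ : ℝ}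
    (hδ : 0 < δ) : Tendsto (fun n : ℕ => n * (δ * μ n) ^ 2) atTop atTop := by
  have h1 := (hμ_inv.tendsto_div_nhds_zero.pow 2).const_mul (δ ^ 2)⁻¹
  rw [zero_pow two_ne_zero, mul_zero] at h1
  -- This sequence is the reciprocal of the target; strict positivity lets it be inverted at `0`.
  have h2 : Tendsto (fun n : ℕ => ((δ ^ 2)⁻¹ * ((μ n)⁻¹ / (n : ℝ) ^ (1 / 2 : ℝ)) ^ 2))
      atTop (𝓝[>] 0) := by
    refine tendsto_nhdsWithin_iff.2 ⟨h1, ?_⟩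
    filter_upwards [eventually_gt_atTop 0] with n hn
    have := hμ_pos n
    have hn' : (0 : ℝ) < n := Nat.cast_pos.2 hn
    exact Set.mem_Ioi.2 (by positivity)
  refine (tendsto_inv_nhdsGT_zero.comp h2).congr fun n => ?_
  have h3 : ((n : ℝ) ^ (1 / 2 : ℝ)) ^ 2 = n := by
    rw [← Real.sqrt_eq_rpow, Real.sq_sqrt n.cast_nonneg]
  have := hμ_pos n
  simp only [Function.comp_apply, div_pow, h3, mul_inv, inv_inv, inv_div, inv_pow, mul_pow]
  field_simp

theorem holdsWithProbabilityTendingToOne_of_compl [IsProbabilityMeasure P] {A : ℕ → Set Ω}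
    (h : Tendsto (fun n => P (A n)ᶜ) atTop (𝓝 0)) : HoldsWithProbabilityTendingToOne P A := by
  refine ⟨?_, h⟩
  have h1 : Tendsto (fun n => 1 - P (A n)ᶜ) atTop (𝓝 (1 - 0)) :=
    ENNReal.Tendsto.sub tendsto_const_nhds h (.inl ENNReal.one_ne_top)
  rw [tsub_zero] at h1
  refine tendsto_of_tendsto_of_tendsto_of_le_of_le h1 tendsto_const_nhds (fun n => ?_)
    fun n => prob_le_one
  -- Only subadditivity is used, so `A n` need not be measurable.
  rw [tsub_le_iff_right, ← measure_univ (μ := P), ← Set.union_compl_self (A n)]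
  exact measure_union_le _ _

/-- Finite unions of events of vanishing probability. -/
theorem tendsto_measure_iUnion_zero {ι : Type*} [Finite ι] {A : ι → ℕ → Set Ω}
    (h : ∀ i, Tendsto (fun n => P (A i n)) atTop (𝓝 0)) :
    Tendsto (fun n => P (⋃ i, A i n)) atTop (𝓝 0) := by
  have := Fintype.ofFinite ι
  have h1 : Tendsto (fun n => ∑ i, P (A i n)) atTop (𝓝 0) := by
    simpa using tendsto_finsetSum Finset.univ fun i _ => h i
  exact tendsto_of_tendsto_of_tendsto_of_le_of_le tendsto_const_nhds h1 (fun _ => zero_le)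
    fun n => measure_iUnion_fintype_le _ _

end Averages

/-! ### Empirical moments of the regression model. -/

section Regression

variable {Ω : Type*} {p : ℕ}

/-- The entries of `X* X / n`. -/
noncomputable def gramEntry (ξ : ℕ → Ω → EuclideanSpace ℝ (Fin p)) (n : ℕ) (ω : Ω)
    (j k : Fin p) : ℝ :=
  (n : ℝ)⁻¹ * ∑ i : Fin n, ξ i ω j * ξ i ω k

/-- The entries of `X* w / n`. -/
noncomputable def noiseEntry (ξ : ℕ → Ω → EuclideanSpace ℝ (Fin p)) (w : ℕ → Ω → ℝ) (n : ℕ)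
    (ω : Ω) (j : Fin p) : ℝ :=
  (n : ℝ)⁻¹ * ∑ i : Fin n, ξ i ω j * w i ω

/-- A matrix of coefficients as a continuous linear operator. -/
noncomputable def toOperator : (Fin p → Fin p → ℝ) →ₗ[ℝ]
    (EuclideanSpace ℝ (Fin p) →L[ℝ] EuclideanSpace ℝ (Fin p)) :=
  LinearMap.toContinuousLinearMap.toLinearMap ∘ₗ Matrix.toEuclideanLin.toLinearMap ∘ₗ
    (Matrix.ofLinearEquiv ℝ).toLinearMap

theorem toLinearMap_toOperator (G : Fin p → Fin p → ℝ) :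
    (toOperator G).toLinearMap = Matrix.toEuclideanLin (Matrix.of G) := rfl

theorem empiricalCovariance_eq (ξ : ℕ → Ω → EuclideanSpace ℝ (Fin p)) (n : ℕ) (ω : Ω) :
    empiricalCovariance ξ n ω = (toOperator (gramEntry ξ n ω)).toLinearMap := by
  rw [toLinearMap_toOperator, empiricalCovariance]
  congr 1

theorem empiricalCovariance_isPositive (ξ : ℕ → Ω → EuclideanSpace ℝ (Fin p)) (n : ℕ) (ω : Ω) :
    (empiricalCovariance ξ n ω).IsPositive := by
  rw [empiricalCovariance, Matrix.isPositive_toEuclideanLin_iff]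
  refine Matrix.PosSemidef.smul ?_ (by positivity)
  have := Matrix.posSemidef_conjTranspose_mul_self (design ξ n ω)
  rwa [Matrix.conjTranspose_eq_transpose_of_trivial] at this

theorem empiricalCorrelation_eq (ξ : ℕ → Ω → EuclideanSpace ℝ (Fin p)) (w : ℕ → Ω → ℝ)
    (β₀ : EuclideanSpace ℝ (Fin p)) (n : ℕ) (ω : Ω) :
    empiricalCorrelation ξ w β₀ n ω =
      empiricalCovariance ξ n ω β₀ + WithLp.toLp 2 (noiseEntry ξ w n ω) := by
  have h1 : empiricalCovariance ξ n ω β₀ = (n : ℝ)⁻¹ •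
      Matrix.toEuclideanLin (design ξ n ω)ᵀ (Matrix.toEuclideanLin (design ξ n ω) β₀) := by
    ext j
    simp [empiricalCovariance, Matrix.toLpLin_apply, Matrix.mulVec_mulVec]
  have h2 : WithLp.toLp 2 (noiseEntry ξ w n ω) = (n : ℝ)⁻¹ •
      Matrix.toEuclideanLin (design ξ n ω)ᵀ (WithLp.toLp 2 (fun i : Fin n => w i ω)) := by
    ext j
    simp [noiseEntry, design, Matrix.toLpLin_apply, Matrix.mulVec, dotProduct]
  rw [empiricalCorrelation, observation, h1, h2, map_add, smul_add]

/-- The quadratic form at `y` is the expectation of `(∑ j, y j * x j) ^ 2`. -/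
theorem covariance_isPositive [MeasurableSpace Ω] {P : Measure Ω}
    {x : Ω → EuclideanSpace ℝ (Fin p)} (hx : ∀ j k, Integrable (fun ω => x ω j * x ω k) P) :
    (covariance P x).IsPositive := by
  rw [covariance, Matrix.isPositive_toEuclideanLin_iff]
  refine Matrix.PosSemidef.of_dotProduct_mulVec_nonneg ?_ fun y => ?_
  · ext j k
    simp [mul_comm]
  · have h1 : ∀ j k, Integrable (fun ω => y j * (x ω j * x ω k * y k)) P := fun j k =>
      ((hx j k).mul_const _).const_mul _
    have h2 : star y ⬝ᵥ (Matrix.of fun j k => ∫ ω, x ω j * x ω k ∂P) *ᵥ y =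
        ∫ ω, (∑ j, y j * x ω j) ^ 2 ∂P := by
      simp only [dotProduct, Matrix.mulVec, Pi.star_apply, star_trivial, Matrix.of_apply,
        Finset.mul_sum, ← integral_mul_const, ← integral_const_mul]
      rw [Finset.sum_congr rfl fun j _ => (integral_finsetSum _ fun k _ => h1 j k).symm,
        ← integral_finsetSum _ fun j _ => integrable_finsetSum _ fun k _ => h1 j k]
      refine integral_congr_ae (.of_forall fun ω => ?_)
      simp only [sq, Finset.sum_mul_sum]
      exact Finset.sum_congr rfl fun j _ => Finset.sum_congr rfl fun k _ => by ring
    rw [h2]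
    exact integral_nonneg fun ω => sq_nonneg _

variable [MeasurableSpace Ω] {P : Measure Ω}

theorem memLp_mul_coord {x : Ω → EuclideanSpace ℝ (Fin p)} (hx : Measurable x)
    (hx4 : Integrable (fun ω => ‖x ω‖ ^ 4) P) (j k : Fin p) :
    MemLp (fun ω => x ω j * x ω k) 2 P := by
  have hm : Measurable fun ω => x ω j * x ω k := by fun_prop
  rw [memLp_two_iff_integrable_sq hm.aestronglyMeasurable]
  refine hx4.mono (hm.pow_const 2).aestronglyMeasurable (.of_forall fun ω => ?_)
  have h1 : |x ω j| ≤ ‖x ω‖ := PiLp.norm_apply_le (x ω) j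
  have h2 : |x ω k| ≤ ‖x ω‖ := PiLp.norm_apply_le (x ω) k
  rw [Real.norm_of_nonneg (by positivity), Real.norm_of_nonneg (by positivity), mul_pow,
    ← sq_abs (x ω j), ← sq_abs (x ω k)]
  calc _ ≤ ‖x ω‖ ^ 2 * ‖x ω‖ ^ 2 := by gcongr
    _ = _ := by ring

/-- `‖x‖² v² ≤ ‖x‖⁴ + v⁴`, so `x` and `v` need not be independent. -/
theorem memLp_coord_mul {x : Ω → EuclideanSpace ℝ (Fin p)} {v : Ω → ℝ} (hx : Measurable x)
    (hv : Measurable v) (hx4 : Integrable (fun ω => ‖x ω‖ ^ 4) P)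
    (hv4 : Integrable (fun ω => v ω ^ 4) P) (j : Fin p) :
    MemLp (fun ω => x ω j * v ω) 2 P := by
  have hm : Measurable fun ω => x ω j * v ω := by fun_prop
  rw [memLp_two_iff_integrable_sq hm.aestronglyMeasurable]
  refine (hx4.add hv4).mono (hm.pow_const 2).aestronglyMeasurable (.of_forall fun ω => ?_)
  have h1 : |x ω j| ≤ ‖x ω‖ := PiLp.norm_apply_le (x ω) j
  have h3 : 0 ≤ ‖x ω‖ ^ 4 + v ω ^ 4 := by positivity
  rw [Real.norm_of_nonneg (by positivity), Pi.add_apply, Real.norm_of_nonneg h3, mul_pow,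
    ← sq_abs (x ω j)]
  calc _ ≤ ‖x ω‖ ^ 2 * v ω ^ 2 := by gcongr
    _ ≤ ‖x ω‖ ^ 4 + v ω ^ 4 := by
      nlinarith [sq_nonneg (‖x ω‖ ^ 2 - v ω ^ 2), sq_nonneg (‖x ω‖ ^ 2), sq_nonneg (v ω ^ 2)]

/-- Conditionally on `x`, the factor `x j` comes out of the expectation. -/
theorem integral_coord_mul_eq_zero [IsProbabilityMeasure P]
    {x : Ω → EuclideanSpace ℝ (Fin p)} {v : Ω → ℝ} (hx : Measurable x) (hv : Integrable v P) (j : Fin p)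
    (hxv : Integrable (fun ω => x ω j * v ω) P)
    (hmean : P[v | MeasurableSpace.comap x inferInstance] =ᵐ[P] 0) :
    ∫ ω, x ω j * v ω ∂P = 0 := by
  have hm : MeasurableSpace.comap x inferInstance ≤ ‹MeasurableSpace Ω› := hx.comap_le
  have hxm : StronglyMeasurable[MeasurableSpace.comap x inferInstance] fun ω => x ω j :=
    ((EuclideanSpace.proj (𝕜 := ℝ) j).continuous.measurable.comp
      (comap_measurable x)).stronglyMeasurable
  have h1 := condExp_mul_of_stronglyMeasurable_left hxm hxv hv
  rw [← integral_condExp hm]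
  refine integral_eq_zero_of_ae (h1.trans ?_)
  filter_upwards [hmean] with ω hω
  simp [hω]

end Regression

/-! ### From filters to a uniform radius. -/

section Perturbation

variable {p : ℕ} {J : EuclideanSpace ℝ (Fin p) → ℝ} {M : Set (EuclideanSpace ℝ (Fin p))}
  {β₀ : EuclideanSpace ℝ (Fin p)}

/-- Model selection for all parameters within a uniform distance of their limits. -/
theorem LocallyPartlySmoothAt.exists_uniform_radius (hJ : ConvexOn ℝ Set.univ J)
    (h : LocallyPartlySmoothAt J M β₀) {G₀ : Fin p → Fin p → ℝ}
    (hG₀ : (toOperator G₀).toLinearMap.IsPositive)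
    (hirr : IrrepresentableCondition J β₀ (toOperator G₀).toLinearMap) :
    ∃ δ > 0, ∀ (μ : ℝ) (e : Fin p → ℝ) (G : Fin p → Fin p → ℝ), 0 < μ → μ < δ →
      (toOperator G).toLinearMap.IsPositive → (∀ j, |e j| < δ * μ) →
      (∀ j k, |G j k - G₀ j k| < δ) →
      ∃ β ∈ M, solutions J μ ((toOperator G).toLinearMap β₀ + WithLp.toLp 2 e)
        (toOperator G).toLinearMap = {β} := by
  -- The middle coordinate is the noise already divided by `μ`, so `ε / μ → 0` becomes plain
  -- convergence to `0`.
  let l : Filter (ℝ × (Fin p → ℝ) × (Fin p → Fin p → ℝ)) := 𝓝 (0, 0, G₀) ⊓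
    𝓟 {a | 0 < a.1 ∧ (toOperator a.2.2).toLinearMap.IsPositive}
  have hl : l ≤ 𝓝 (0, 0, G₀) := inf_le_left
  have hl2 : ∀ᶠ a in l, 0 < a.1 ∧ (toOperator a.2.2).toLinearMap.IsPositive :=
    mem_inf_of_right (mem_principal_self _)
  have hop : Continuous (toOperator (p := p)) := LinearMap.continuous_of_finiteDimensional _
  have hμ0 : Tendsto (fun a : ℝ × (Fin p → ℝ) × (Fin p → Fin p → ℝ) => a.1) l (𝓝 0) :=
    (continuous_fst.tendsto _).mono_left hl
  have hΓ : Tendsto (fun a : ℝ × (Fin p → ℝ) × (Fin p → Fin p → ℝ) => toOperator a.2.2) l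
      (𝓝 (toOperator G₀)) :=
    ((hop.comp (continuous_snd.comp continuous_snd)).tendsto (0, 0, G₀)).mono_left hl
  have hε : Tendsto (fun a : ℝ × (Fin p → ℝ) × (Fin p → Fin p → ℝ) =>
      a.1⁻¹ • a.1 • (WithLp.toLp 2 a.2.1 : EuclideanSpace ℝ (Fin p))) l (𝓝 0) := by
    have hc : Continuous fun a : ℝ × (Fin p → ℝ) × (Fin p → Fin p → ℝ) =>
        (WithLp.toLp 2 a.2.1 : EuclideanSpace ℝ (Fin p)) := by fun_prop
    have h1 := (hc.tendsto (0, 0, G₀)).mono_left hl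
    refine Tendsto.congr' ?_ h1
    filter_upwards [hl2] with a ha
    rw [inv_smul_smul₀ ha.1.ne']
  have hmain := h.eventually_solutions hJ hG₀ hirr (hl2.mono fun a ha => ha.1) hμ0 hε hΓ
    (hl2.mono fun a ha => ha.2)
  rw [eventually_inf_principal, Metric.eventually_nhds_iff] at hmain
  obtain ⟨δ, hδ, hmain⟩ := hmain
  refine ⟨δ, hδ, fun μ e G hμ hμδ hpos he hG => ?_⟩
  have hdist : dist (μ, μ⁻¹ • e, G) (0, 0, G₀) < δ := by
    rw [Prod.dist_eq, Prod.dist_eq]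
    refine max_lt ?_ (max_lt ?_ ?_)
    · simpa [abs_of_pos hμ] using hμδ
    · refine (dist_pi_lt_iff hδ).2 fun j => ?_
      simp only [Pi.smul_apply, smul_eq_mul, Pi.zero_apply, dist_zero_right, norm_mul, norm_inv,
        Real.norm_eq_abs, abs_of_pos hμ]
      rw [inv_mul_lt_iff₀ hμ, mul_comm]
      exact he j
    · exact (dist_pi_lt_iff hδ).2 fun j => (dist_pi_lt_iff hδ).2 fun k => hG j k
  have h1 := hmain hdist ⟨hμ, hpos⟩
  simp only [WithLp.toLp_smul, smul_inv_smul₀ hμ.ne'] at h1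
  exact h1

end Perturbation

end PartlySmooth

/-! ### Conclusion: the probabilistic statement. -/

theorem theorem2 {p : ℕ} {Ω : Type*} [MeasurableSpace Ω] (P : Measure Ω) [IsProbabilityMeasure P]
    (J : EuclideanSpace ℝ (Fin p) → ℝ) (hJ : ConvexOn ℝ Set.univ J)
    (β₀ : EuclideanSpace ℝ (Fin p)) (M : Set (EuclideanSpace ℝ (Fin p)))
    (hM : PartlySmooth.LocallyPartlySmoothAt J M β₀)
    (ξ : ℕ → Ω → EuclideanSpace ℝ (Fin p)) (w : ℕ → Ω → ℝ)
    (hξ : ∀ i, Measurable (ξ i)) (hw : ∀ i, Measurable (w i))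
    (hindep : iIndepFun (fun i ω => (ξ i ω, w i ω)) P)
    (hident : ∀ i, IdentDistrib (fun ω => (ξ i ω, w i ω)) (fun ω => (ξ 0 ω, w 0 ω)) P P)
    (hmean : ∀ i, P[w i | MeasurableSpace.comap (ξ i) inferInstance] =ᵐ[P] 0)
    (hw4 : ∀ i, Integrable (fun ω => w i ω ^ 4) P)
    (hξ4 : ∀ i, Integrable (fun ω => ‖ξ i ω‖ ^ 4) P)
    (hirr : PartlySmooth.IrrepresentableCondition J β₀ (PartlySmooth.covariance P (ξ 0)))
    (μ : ℕ → ℝ) (hμ_pos : ∀ n, 0 < μ n)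
    (hμ : Tendsto μ atTop (𝓝 0))
    (hμ_inv : (fun n => (μ n)⁻¹) =o[atTop] (fun n : ℕ => (n : ℝ) ^ (1 / 2 : ℝ))) :
    PartlySmooth.HoldsWithProbabilityTendingToOne P
      (fun n => PartlySmooth.modelSelected J M ξ w β₀ (μ n) n) := by
  have hLgram : ∀ j k i, MemLp (fun ω => ξ i ω j * ξ i ω k) 2 P := fun j k i =>
    PartlySmooth.memLp_mul_coord (hξ i) (hξ4 i) j k
  have hLnoise : ∀ j i, MemLp (fun ω => ξ i ω j * w i ω) 2 P := fun j i =>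
    PartlySmooth.memLp_coord_mul (hξ i) (hw i) (hξ4 i) (hw4 i) j
  have hwint : Integrable (w 0) P := by
    have h4 : MemLp (w 0) 4 P := by
      rw [← integrable_norm_rpow_iff (hw 0).aestronglyMeasurable (by norm_num) (by norm_num)]
      refine (hw4 0).congr (.of_forall fun ω => ?_)
      simp only [ENNReal.toReal_ofNat]
      rw [show (4 : ℝ) = ((4 : ℕ) : ℝ) by norm_num, Real.rpow_natCast, Real.norm_eq_abs,
        Even.pow_abs (by decide)]
    exact h4.integrable (by norm_num)
  let G₀ : Fin p → Fin p → ℝ := fun j k => ∫ ω, ξ 0 ω j * ξ 0 ω k ∂P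
  have hG₀ : PartlySmooth.covariance P (ξ 0) = (PartlySmooth.toOperator G₀).toLinearMap := rfl
  have hG₀pos : (PartlySmooth.toOperator G₀).toLinearMap.IsPositive := by
    rw [← hG₀]
    exact PartlySmooth.covariance_isPositive fun j k => (hLgram j k 0).integrable one_le_two
  rw [hG₀] at hirr
  obtain ⟨δ, hδ, hsel⟩ := hM.exists_uniform_radius hJ hG₀pos hirr
  -- Bad events: a Gram entry is off by at least `δ`, or a noise entry is at least `δ * μ n` in
  -- absolute value. Once `μ n < δ`, selection can fail only on their union.
  let B : (Fin p × Fin p) ⊕ Fin p → ℕ → Set Ω := Sum.elim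
    (fun jk n => {ω | δ ≤ |PartlySmooth.gramEntry ξ n ω jk.1 jk.2 - G₀ jk.1 jk.2|})
    (fun j n => {ω | δ * μ n ≤ |PartlySmooth.noiseEntry ξ w n ω j|})
  have hB : Tendsto (fun n => P (⋃ i, B i n)) atTop (𝓝 0) := by
    refine PartlySmooth.tendsto_measure_iUnion_zero ?_
    rintro (⟨j, k⟩ | j)
    · have hφ : Measurable fun x : EuclideanSpace ℝ (Fin p) × ℝ => x.1 j * x.1 k := by fun_prop
      refine PartlySmooth.tendsto_measure_average_deviation (Z := fun i ω => ξ i ω j * ξ i ω k)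
        (hLgram j k)
        (fun a b hab => (hindep.indepFun hab).comp hφ hφ) (fun i => (hident i).comp hφ)
        (c := fun _ => δ) (fun _ => hδ) ?_
      exact tendsto_natCast_atTop_atTop.atTop_mul_const (by positivity)
    · have hφ : Measurable fun x : EuclideanSpace ℝ (Fin p) × ℝ => x.1 j * x.2 := by fun_prop
      have h := PartlySmooth.tendsto_measure_average_deviation (Z := fun i ω => ξ i ω j * w i ω)
        (hLnoise j)
        (fun a b hab => (hindep.indepFun hab).comp hφ hφ) (fun i => (hident i).comp hφ)
        (c := fun n => δ * μ n) (fun n => mul_pos hδ (hμ_pos n))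
        (PartlySmooth.tendsto_mul_sq_of_inv_isLittleO hμ_pos hμ_inv hδ)
      simp only [PartlySmooth.integral_coord_mul_eq_zero (hξ 0) hwint j
        ((hLnoise j 0).integrable one_le_two)
        (hmean 0), sub_zero] at h
      exact h
  refine PartlySmooth.holdsWithProbabilityTendingToOne_of_compl ?_
  refine tendsto_of_tendsto_of_tendsto_of_le_of_le' tendsto_const_nhds hB
    (.of_forall fun _ => zero_le) ?_
  filter_upwards [hμ.eventually (gt_mem_nhds hδ)] with n hn
  refine measure_mono fun ω hω => ?_
  by_contra hnot
  simp only [Set.mem_iUnion, not_exists] at hnot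
  refine hω ?_
  have hpos := PartlySmooth.empiricalCovariance_isPositive ξ n ω
  rw [PartlySmooth.empiricalCovariance_eq] at hpos
  obtain ⟨β, hβM, hβ⟩ := hsel (μ n) (PartlySmooth.noiseEntry ξ w n ω)
    (PartlySmooth.gramEntry ξ n ω) (hμ_pos n) hn hpos
    (fun j => not_le.1 (hnot (.inr j))) (fun j k => not_le.1 (hnot (.inl (j, k))))
  refine ⟨β, hβM, ?_⟩
  rw [PartlySmooth.empiricalCorrelation_eq, PartlySmooth.empiricalCovariance_eq]
  exact hβ
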